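/- \textbf{Setting.} Let $\mathbb{P}\subseteq\mathbb{R}^{n_{\mathrm p}}$ be non-empty, open and connected, and let $\mathcal{R}$ be the field of real-meromorphic functions on $\mathbb{P}^{\mathbb{Z}}$ of finitely many samples, i.e. quotients $g/h$, $h\not\equiv 0$, of real-analytic functions of finitely many of the variables $p(i)\in\mathbb{P}$, $i\in\mathbb{Z}$. For $r\in\mathcal{R}$ and $p\in\mathbb{P}^{\mathbb{Z}}$ put $(r\diamond p)(k)=r\big((p(k+i))_{i\in\mathbb{Z}}\big)$ (entrywise for matrices). Let $\mu$ be a non-zero measure on $\mathbb{P}^{\mathbb{Z}}$ for which the zero set of every analytic function $h\not\equiv0$ of finitely many samples is a null set (for instance a product over $\mathbb{Z}$ of probability measures on $\mathbb{P}$ that are absolutely continuous with respect to Lebesgue measure). "Almost every $p$" refers to $\mu$; for almost every $p$, any given $r\in\mathcal{R}$ is well defined along $p$ at all times $k\in\mathbb Z$. Let $w=\mathrm{col}(u,y)$ with $u(k)\in\mathbb{R}^{n_{\mathrm u}}$, $y(k)\in\mathbb{R}^{n_{\mathrm y}}$, $n_{\mathrm w}=n_{\mathrm u}+n_{\mathrm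 y}$. For a polynomial row $n(\xi)=\sum_i n_i\xi^i$ with coefficients $n_i\in\mathcal{R}^{1\times n_{\mathrm w}}$ write $\big((n(\mathrm q)\diamond p)w\big)(k)=\sum_i (n_i\diamond p)(k)\,w(k+i)$. Let $\mathfrak{B}\subseteq(\mathbb{R}^{n_{\mathrm w}}\times\mathbb{P})^{\mathbb{Z}}$ be a behaviour. \begin{itemize} \item Matrices $A,B,C,D$ over $\mathcal{R}$ with state dimension $n_{\mathrm x}$ are a \emph{state-space representation} of $\mathfrak{B}$ if for almost every $p$ and all $w=\mathrm{col}(u,y)$: $(w,p)\in\mathfrak{B}$ if and only if there is $x:\mathbb{Z}\to\mathbb{R}^{n_{\mathrm x}}$ with $x(k+1)=(A\diamond p)(k)x(k)+(B\diamond p)(k)u(k)$ and $y(k)=(C\diamond p)(k)x(k)+(D\diamond p)(k)u(k)$ for all $k\in\mathbb{Z}$. Let $\mathbf{n}(\mathfrak{B})$ be the smallest state dimension among all state-space representations of $\mathfrak{B}$. \item A polynomial matrix $R(\xi)$ over $\mathcal{R}$ with $n_{\mathrm w}$ columns and finitely many rows is a \emph{kernel representation} of $\mathfrak{B}$ if for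 almost every $p$ and all $w$: $(w,p)\in\mathfrak{B}$ if and only if $(R(\mathrm q)\diamond p)w=0$. Its order is the highest degree of its entries. The lag $\mathbf{L}(\mathfrak{B})$ is the smallest order of a kernel representation of $\mathfrak{B}$. \item $\mathrm{Ann}_{d}(\mathfrak{B})$ is the left $\mathcal{R}$-vector space of all polynomial rows $n(\xi)$ with coefficients in $\mathcal{R}^{1\times n_{\mathrm w}}$ and entries of degree $\le d$ such that, for almost every $p$, $(n(\mathrm q)\diamond p)w=0$ for all $w$ with $(w,p)\in\mathfrak{B}$ (so $\mathrm{Ann}_{-1}(\mathfrak{B})=\{0\}$). \end{itemize} \textbf{Corollary.} Suppose that $\mathfrak{B}$ has a state-space representation. If $L\in\mathbb{N}$, $L\ge\mathbf{L}(\mathfrak{B})$, then $\mathrm{Ann}_{L-1}(\mathfrak{B})$ is finite-dimensional over $\mathcal{R}$ and $$\dim_{\mathcal{R}}\mathrm{Ann}_{L-1}(\mathfrak{B})=n_{\mathrm y}L-\mathbf{n}(\mathfrak{B}).$$ -/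

import Mathlib

open MeasureTheory Polynomial

noncomputable section

namespace LPV

/-- The time shift `(shift k p) i = p (i + k)` of a bi-infinite sequence. -/
def shift {α : Type*} (k : ℤ) (p : ℤ → α) : ℤ → α := fun i => p (i + k)

/-- `f : P^ℤ → ℝ` depends on finitely many time samples `p(i)`, `i ∈ S`, and is a real-analytic
function of them on `P^S`. -/
def IsAnalyticDep {np : ℕ} (P : Set (Fin np → ℝ)) (f : (ℤ → P) → ℝ) : Prop :=
  ∃ (S : Finset ℤ) (F : (S → Fin np → ℝ) → ℝ),
    AnalyticOnNhd ℝ F (Set.univ.pi fun _ => P) ∧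
      ∀ p : ℤ → P, f p = F fun i => (p i : Fin np → ℝ)

theorem IsAnalyticDep.enlarge {np : ℕ} {P : Set (Fin np → ℝ)} {S T : Finset ℤ} (h : S ⊆ T)
    {F : (S → Fin np → ℝ) → ℝ} (hF : AnalyticOnNhd ℝ F (Set.univ.pi fun _ => P)) :
    AnalyticOnNhd ℝ (fun x : T → Fin np → ℝ => F fun i => x ⟨i, h i.2⟩)
      (Set.univ.pi fun _ => P) := by
  let ℓ : (T → Fin np → ℝ) →L[ℝ] (S → Fin np → ℝ) :=
    ContinuousLinearMap.pi fun i => ContinuousLinearMap.proj ⟨i.1, h i.2⟩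
  intro x hx
  have h1 : AnalyticAt ℝ F (ℓ x) := hF _ fun i _ => hx _ (Set.mem_univ _)
  exact h1.comp (ℓ.analyticAt x)

theorem IsAnalyticDep.map₂ {np : ℕ} {P : Set (Fin np → ℝ)} {f g : (ℤ → P) → ℝ}
    (hf : IsAnalyticDep P f) (hg : IsAnalyticDep P g) (op : ℝ → ℝ → ℝ)
    (hop : ∀ (T : Finset ℤ) (F G : (T → Fin np → ℝ) → ℝ) (s : Set (T → Fin np → ℝ)),
      AnalyticOnNhd ℝ F s → AnalyticOnNhd ℝ G s →
        AnalyticOnNhd ℝ (fun x => op (F x) (G x)) s) :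
    IsAnalyticDep P fun p => op (f p) (g p) := by
  obtain ⟨S, F, hF, hfF⟩ := hf
  obtain ⟨T, G, hG, hgG⟩ := hg
  refine ⟨S ∪ T, _, hop _ _ _ _ (IsAnalyticDep.enlarge Finset.subset_union_left hF)
    (IsAnalyticDep.enlarge Finset.subset_union_right hG), fun p => ?_⟩
  simp only [hfF, hgG]

theorem IsAnalyticDep.const {np : ℕ} (P : Set (Fin np → ℝ)) (c : ℝ) :
    IsAnalyticDep P fun _ => c :=
  ⟨∅, fun _ => c, fun _ _ => analyticAt_const, fun _ => rfl⟩

theorem IsAnalyticDep.comp_shift {np : ℕ} {P : Set (Fin np → ℝ)} {f : (ℤ → P) → ℝ}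
    (hf : IsAnalyticDep P f) (k : ℤ) : IsAnalyticDep P fun p => f (shift k p) := by
  obtain ⟨S, F, hF, hfF⟩ := hf
  let T : Finset ℤ := S.image (· + k)
  have hT : ∀ i : S, (i : ℤ) + k ∈ T := fun i => Finset.mem_image_of_mem _ i.2
  let ℓ : (T → Fin np → ℝ) →L[ℝ] (S → Fin np → ℝ) :=
    ContinuousLinearMap.pi fun i => ContinuousLinearMap.proj ⟨i.1 + k, hT i⟩
  refine ⟨T, fun x => F (ℓ x), fun x hx => ?_, fun p => hfF _⟩
  have h1 : AnalyticAt ℝ F (ℓ x) := hF _ fun i _ => hx _ (Set.mem_univ _)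
  exact h1.comp (ℓ.analyticAt x)

/-- The ring of real-analytic functions on `P^ℤ` that depend on finitely many samples. -/
def AnalyticDep {np : ℕ} (P : Set (Fin np → ℝ)) : Subring ((ℤ → P) → ℝ) where
  carrier := {f | IsAnalyticDep P f}
  mul_mem' hf hg := hf.map₂ hg (· * ·) fun _ _ _ _ h1 h2 => h1.mul h2
  one_mem' := IsAnalyticDep.const P 1
  add_mem' hf hg := hf.map₂ hg (· + ·) fun _ _ _ _ h1 h2 => h1.add h2
  zero_mem' := IsAnalyticDep.const P 0
  neg_mem' {f} hf := by
    have := (IsAnalyticDep.const P 0).map₂ hf (· - ·) fun _ _ _ _ h1 h2 => h1.sub h2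
    simpa [sub_eq_add_neg, Pi.neg_def] using this

/-- `ℛ(P)`: real-meromorphic functions, i.e. quotients `g / h` of real-analytic functions with
`h ≠ 0`, of finitely many samples of the scheduling signal. It is a field for `P` open and
connected, see `isField_mero`. -/
def Mero {np : ℕ} (P : Set (Fin np → ℝ)) : Type := FractionRing (AnalyticDep P)

instance {np : ℕ} (P : Set (Fin np → ℝ)) : CommRing (Mero P) :=
  inferInstanceAs (CommRing (FractionRing (AnalyticDep P)))

instance {np : ℕ} (P : Set (Fin np → ℝ)) : Algebra (AnalyticDep P) (Mero P) :=
  inferInstanceAs (Algebra (AnalyticDep P) (FractionRing (AnalyticDep P)))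

instance {np : ℕ} (P : Set (Fin np → ℝ)) : IsFractionRing (AnalyticDep P) (Mero P) :=
  inferInstanceAs (IsFractionRing (AnalyticDep P) (FractionRing (AnalyticDep P)))

theorem isDomain_analyticDep {np : ℕ} {P : Set (Fin np → ℝ)} (hPo : IsOpen P)
    (hPc : IsConnected P) : IsDomain (AnalyticDep P) := by
  obtain ⟨⟨a, ha⟩, hpre⟩ := hPc
  have hnt : Nontrivial (AnalyticDep P) := by
    refine ⟨0, 1, fun h01 => ?_⟩
    have : (0 : ℝ) = 1 := congrFun (congrArg Subtype.val h01) fun _ => ⟨a, ha⟩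
    norm_num at this
  have hnz : NoZeroDivisors (AnalyticDep P) := by
    refine ⟨fun {f g} hfg => ?_⟩
    obtain ⟨S₁, F₁, hF₁, hfF⟩ := f.2
    obtain ⟨S₂, G₁, hG₁, hgG⟩ := g.2
    have hF := IsAnalyticDep.enlarge (Finset.subset_union_left (s₁ := S₁) (s₂ := S₂)) hF₁
    have hG := IsAnalyticDep.enlarge (Finset.subset_union_right (s₁ := S₁) (s₂ := S₂)) hG₁
    set F := fun x : ↥(S₁ ∪ S₂) → Fin np → ℝ => F₁ fun i => x ⟨i, Finset.subset_union_left i.2⟩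
    set G := fun x : ↥(S₁ ∪ S₂) → Fin np → ℝ => G₁ fun i => x ⟨i, Finset.subset_union_right i.2⟩
    set U : Set (↥(S₁ ∪ S₂) → Fin np → ℝ) := Set.univ.pi fun _ => P
    have hUo : IsOpen U := isOpen_set_pi Set.finite_univ fun _ _ => hPo
    have hUc : IsPreconnected U := isPreconnected_univ_pi fun _ => hpre
    have hFG : ∀ x ∈ U, F x * G x = 0 := by
      intro x hx
      let p : ℤ → P := fun i => if h : i ∈ S₁ ∪ S₂ then ⟨x ⟨i, h⟩, hx _ (Set.mem_univ _)⟩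
        else ⟨a, ha⟩
      have h1 : f.1 p * g.1 p = 0 := congrFun (congrArg Subtype.val hfg) p
      rw [hfF, hgG] at h1
      have h2 : ∀ i (h : i ∈ S₁ ∪ S₂), (p i : Fin np → ℝ) = x ⟨i, h⟩ := fun i h => by
        simp only [p, dif_pos h]
      have h3 : F x = F₁ fun i => (p i : Fin np → ℝ) :=
        congrArg F₁ (funext fun i => (h2 _ _).symm)
      have h4 : G x = G₁ fun i => (p i : Fin np → ℝ) :=
        congrArg G₁ (funext fun i => (h2 _ _).symm)
      rw [h3, h4, h1]
    by_cases hF0 : ∀ x ∈ U, F x = 0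
    · left
      ext p
      exact (hfF p).trans (hF0 (fun i => p i) fun i _ => (p i).2)
    · right
      push Not at hF0
      obtain ⟨x, hx, hFx⟩ := hF0
      have h5 : ∀ᶠ y in nhds x, F y ≠ 0 := (hF x hx).continuousAt.eventually_ne hFx
      have h6 : G =ᶠ[nhds x] 0 := by
        filter_upwards [h5, hUo.mem_nhds hx] with y hy hyU
        exact (mul_eq_zero.1 (hFG y hyU)).resolve_left hy
      have h7 := hG.eqOn_zero_of_preconnected_of_eventuallyEq_zero hUc hx h6
      ext p
      exact (hgG p).trans (h7 (x := fun i => p i) fun i _ => (p i).2)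
  exact NoZeroDivisors.to_isDomain _

theorem isField_mero {np : ℕ} {P : Set (Fin np → ℝ)} (hPo : IsOpen P) (hPc : IsConnected P) :
    IsField (Mero P) := by
  have := isDomain_analyticDep hPo hPc
  exact (IsFractionRing.toField (AnalyticDep P) (K := Mero P)).toIsField

open Classical in
/-- The value of `r ∈ ℛ(P)` at `p`: `g p / h p` for a representation `r = g / h` whose denominator
does not vanish at `p` (all these give the same value, see `eval_mk'`), and the default value `0`
where there is none, that is where `r` is undefined. -/
def eval {np : ℕ} {P : Set (Fin np → ℝ)} (r : Mero P) (p : ℤ → P) : ℝ :=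
  if h : ∃ gh : AnalyticDep P × nonZeroDivisors (AnalyticDep P),
      gh.2.1.1 p ≠ 0 ∧ r = IsLocalization.mk' (Mero P) gh.1 gh.2 then
    h.choose.1.1 p / h.choose.2.1.1 p
  else 0

theorem eval_mk' {np : ℕ} {P : Set (Fin np → ℝ)} (g : AnalyticDep P)
    (h : nonZeroDivisors (AnalyticDep P)) (p : ℤ → P) (hp : h.1.1 p ≠ 0) :
    eval (IsLocalization.mk' (Mero P) g h) p = g.1 p / h.1.1 p := by
  have hex : ∃ gh : AnalyticDep P × nonZeroDivisors (AnalyticDep P),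
      gh.2.1.1 p ≠ 0 ∧ IsLocalization.mk' (Mero P) g h =
        IsLocalization.mk' (Mero P) gh.1 gh.2 := ⟨(g, h), hp, rfl⟩
  rw [eval, dif_pos hex]
  obtain ⟨h1, h2⟩ := hex.choose_spec
  generalize hex.choose = gh at h1 h2
  rw [IsLocalization.mk'_eq_iff_eq] at h2
  have h3 := IsFractionRing.injective (AnalyticDep P) (Mero P) h2
  have h4 : gh.2.1.1 p * g.1 p = h.1.1 p * gh.1.1 p := congrFun (congrArg Subtype.val h3) p
  rw [div_eq_div_iff h1 hp]
  linarith

/-- `(r ⋄ p)(k)`: the coefficient `r` along the scheduling trajectory `p`, at time `k`. -/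
def diamond {np : ℕ} {P : Set (Fin np → ℝ)} (r : Mero P) (p : ℤ → P) (k : ℤ) : ℝ :=
  eval r (shift k p)

/-- The measures on `P^ℤ` that define "almost everywhere": non-zero, and not charging the zero set
of any non-zero analytic function of finitely many samples. For `P` open and connected, examples
are all products over `ℤ` of probability measures on `P` that are absolutely continuous with
respect to Lebesgue measure. -/
structure IsAdmissible {np : ℕ} {P : Set (Fin np → ℝ)} (μ : Measure (ℤ → P)) : Prop where
  ne_zero : μ ≠ 0
  ae_ne_zero : ∀ f : AnalyticDep P, f ≠ 0 → ∀ᵐ p ∂μ, f.1 p ≠ 0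

theorem IsAdmissible.ae_shift_ne_zero {np : ℕ} {P : Set (Fin np → ℝ)} {μ : Measure (ℤ → P)}
    (hμ : IsAdmissible μ) (h : nonZeroDivisors (AnalyticDep P)) :
    ∀ᵐ p ∂μ, ∀ k : ℤ, h.1.1 (shift k p) ≠ 0 := by
  have hne : Nonempty (ℤ → P) := by
    by_contra hc
    rw [not_nonempty_iff] at hc
    exact hμ.ne_zero (Measure.eq_zero_of_isEmpty μ)
  have hnt : Nontrivial (AnalyticDep P) := by
    refine ⟨0, 1, fun h01 => ?_⟩
    obtain ⟨p⟩ := hne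
    have : (0 : ℝ) = 1 := congrFun (congrArg Subtype.val h01) p
    norm_num at this
  have h0 : h.1 ≠ 0 := nonZeroDivisors.ne_zero h.2
  refine ae_all_iff.2 fun k => ?_
  refine hμ.ae_ne_zero ⟨fun p => h.1.1 (shift k p), IsAnalyticDep.comp_shift h.1.2 k⟩ ?_
  intro hc
  apply h0
  ext p
  have := congrFun (congrArg Subtype.val hc) (shift (-k) p)
  have hs : shift k (shift (-k) p) = p := by
    funext i
    simp [shift]
  simpa [hs] using this

theorem IsAdmissible.ae_diamond_add {np : ℕ} {P : Set (Fin np → ℝ)} {μ : Measure (ℤ → P)}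
    (hμ : IsAdmissible μ) (r s : Mero P) :
    ∀ᵐ p ∂μ, ∀ k, diamond (r + s) p k = diamond r p k + diamond s p k := by
  obtain ⟨g, h, rfl⟩ := IsLocalization.exists_mk'_eq (nonZeroDivisors (AnalyticDep P)) r
  obtain ⟨g', h', rfl⟩ := IsLocalization.exists_mk'_eq (nonZeroDivisors (AnalyticDep P)) s
  filter_upwards [hμ.ae_shift_ne_zero h, hμ.ae_shift_ne_zero h'] with p hp hp' k
  have hm : (h * h').1.1 (shift k p) ≠ 0 := mul_ne_zero (hp k) (hp' k)
  rw [← IsLocalization.mk'_add, diamond, diamond, diamond, eval_mk' _ _ _ (hp k),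
    eval_mk' _ _ _ (hp' k), eval_mk' _ _ _ hm, div_add_div _ _ (hp k) (hp' k)]
  simp [mul_comm]

theorem IsAdmissible.ae_diamond_mul {np : ℕ} {P : Set (Fin np → ℝ)} {μ : Measure (ℤ → P)}
    (hμ : IsAdmissible μ) (r s : Mero P) :
    ∀ᵐ p ∂μ, ∀ k, diamond (r * s) p k = diamond r p k * diamond s p k := by
  obtain ⟨g, h, rfl⟩ := IsLocalization.exists_mk'_eq (nonZeroDivisors (AnalyticDep P)) r
  obtain ⟨g', h', rfl⟩ := IsLocalization.exists_mk'_eq (nonZeroDivisors (AnalyticDep P)) s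
  filter_upwards [hμ.ae_shift_ne_zero h, hμ.ae_shift_ne_zero h'] with p hp hp' k
  have hm : (h * h').1.1 (shift k p) ≠ 0 := mul_ne_zero (hp k) (hp' k)
  rw [← IsLocalization.mk'_mul, diamond, diamond, diamond, eval_mk' _ _ _ (hp k),
    eval_mk' _ _ _ (hp' k), eval_mk' _ _ _ hm, div_mul_div_comm]
  rfl

theorem eval_zero {np : ℕ} {P : Set (Fin np → ℝ)} (p : ℤ → P) : eval (0 : Mero P) p = 0 := by
  have h := eval_mk' (P := P) 0 1 p one_ne_zero
  rw [IsLocalization.mk'_zero] at h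
  exact h.trans (zero_div _)

/-- A behaviour `𝔅 ⊆ (W × P)^ℤ`, with signal space `W = ℝ^ι`. -/
abbrev Behaviour {np : ℕ} (P : Set (Fin np → ℝ)) (ι : Type) : Type :=
  Set ((ℤ → ι → ℝ) × (ℤ → P))

/-- `((n(q) ⋄ p) w)(k) = ∑ᵢ (nᵢ ⋄ p)(k) w(k + i)` for a row `n = ∑ᵢ nᵢ ξⁱ` with entries in `ℛ[ξ]`.
`ℛ[ξ]` is used through its coefficients only (as a left `ℛ`-module with a degree), so that its
twisted multiplication `ξ r = (shifted r) ξ` plays no role here. -/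
def opApply {np : ℕ} {P : Set (Fin np → ℝ)} {ι : Type} [Fintype ι] (n : ι → (Mero P)[X])
    (p : ℤ → P) (w : ℤ → ι → ℝ) (k : ℤ) : ℝ :=
  ∑ j, (n j).sum fun i r => diamond r p k * w (k + i) j

/-- The annihilators of `𝔅`: all `n` with `(n(q) ⋄ p) w = 0` for almost every `p` and all `w`
with `(w, p) ∈ 𝔅`. They form a left `ℛ(P)`-vector space. -/
def annihilators {np : ℕ} {P : Set (Fin np → ℝ)} {ι : Type} [Fintype ι] (μ : Measure (ℤ → P))
    (hμ : IsAdmissible μ) (𝔅 : Behaviour P ι) : Submodule (Mero P) (ι → (Mero P)[X]) where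
  carrier := {n | ∀ᵐ p ∂μ, ∀ w, (w, p) ∈ 𝔅 → ∀ k, opApply n p w k = 0}
  zero_mem' := by
    have h0 : ∀ᵐ p ∂μ, ∀ w, (w, p) ∈ 𝔅 → ∀ k, opApply (0 : ι → (Mero P)[X]) p w k = 0 :=
      Filter.Eventually.of_forall fun p w _ k => by simp [opApply]
    exact h0
  add_mem' {n m} hn hm := by
    have hadd : ∀ᵐ p ∂μ, ∀ (j : ι) (i : ℕ) (k : ℤ),
        diamond ((n j).coeff i + (m j).coeff i) p k =
          diamond ((n j).coeff i) p k + diamond ((m j).coeff i) p k :=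
      ae_all_iff.2 fun j => ae_all_iff.2 fun i => hμ.ae_diamond_add _ _
    filter_upwards [hn, hm, hadd] with p h1 h2 h3 w hw k
    suffices hsum : opApply (n + m) p w k = opApply n p w k + opApply m p w k by
      rw [hsum, h1 w hw k, h2 w hw k, add_zero]
    simp only [opApply, ← Finset.sum_add_distrib]
    refine Finset.sum_congr rfl fun j _ => ?_
    have hz : ∀ i : ℕ, diamond (0 : Mero P) p k * w (k + i) j = 0 := fun i => by
      simp [diamond, eval_zero]
    set N := max (n j).natDegree (m j).natDegree + 1
    rw [Pi.add_apply, sum_over_range' _ hz N ((natDegree_add_le _ _).trans_lt (Nat.lt_succ_self _)),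
      sum_over_range' _ hz N ((le_max_left _ _).trans_lt (Nat.lt_succ_self _)),
      sum_over_range' _ hz N ((le_max_right _ _).trans_lt (Nat.lt_succ_self _)),
      ← Finset.sum_add_distrib]
    refine Finset.sum_congr rfl fun i _ => ?_
    rw [coeff_add, h3, add_mul]
  smul_mem' c n hn := by
    have hmul : ∀ᵐ p ∂μ, ∀ (j : ι) (i : ℕ) (k : ℤ),
        diamond (c * (n j).coeff i) p k = diamond c p k * diamond ((n j).coeff i) p k :=
      ae_all_iff.2 fun j => ae_all_iff.2 fun i => hμ.ae_diamond_mul _ _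
    filter_upwards [hn, hmul] with p h1 h3 w hw k
    suffices hsm : opApply (c • n) p w k = diamond c p k * opApply n p w k by
      rw [hsm, h1 w hw k, mul_zero]
    simp only [opApply, Finset.mul_sum]
    refine Finset.sum_congr rfl fun j _ => ?_
    have hz : ∀ i : ℕ, diamond (0 : Mero P) p k * w (k + i) j = 0 := fun i => by
      simp [diamond, eval_zero]
    rw [Pi.smul_apply, sum_over_range' _ hz ((n j).natDegree + 1)
        ((natDegree_smul_le _ _).trans_lt (Nat.lt_succ_self _)),
      sum_over_range _ hz, Finset.mul_sum]
    refine Finset.sum_congr rfl fun i _ => ?_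
    rw [coeff_smul, smul_eq_mul, h3, mul_assoc]

/-- The annihilators all of whose entries have degree `< L`, i.e. degree `≤ L - 1`. -/
def annihilatorsLT {np : ℕ} {P : Set (Fin np → ℝ)} {ι : Type} [Fintype ι] (μ : Measure (ℤ → P))
    (hμ : IsAdmissible μ) (𝔅 : Behaviour P ι) (L : ℕ) : Submodule (Mero P) (ι → (Mero P)[X]) :=
  annihilators μ hμ 𝔅 ⊓ Submodule.pi Set.univ fun _ => degreeLT (Mero P) L

/-- The kernel behaviour of `R ∈ ℛ[ξ]^{nr × ι}` is `𝔅`, in the almost everywhere sense. -/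
def IsKernelRep {np : ℕ} {P : Set (Fin np → ℝ)} {ι : Type} [Fintype ι] {nr : ℕ}
    (μ : Measure (ℤ → P)) (R : Matrix (Fin nr) ι (Mero P)[X]) (𝔅 : Behaviour P ι) : Prop :=
  ∀ᵐ p ∂μ, ∀ w, (w, p) ∈ 𝔅 ↔ ∀ k i, opApply (R i) p w k = 0

/-- The order of a kernel representation: the highest degree of an entry of `R`. -/
def order {np : ℕ} {P : Set (Fin np → ℝ)} {ι : Type} [Fintype ι] {nr : ℕ}
    (R : Matrix (Fin nr) ι (Mero P)[X]) : ℕ :=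
  Finset.univ.sup fun i => Finset.univ.sup fun j => (R i j).natDegree

/-- The lag `L(𝔅)`: the smallest order of a kernel representation of `𝔅`. -/
def lag {np : ℕ} {P : Set (Fin np → ℝ)} {ι : Type} [Fintype ι] (μ : Measure (ℤ → P))
    (𝔅 : Behaviour P ι) : ℕ :=
  sInf {l | ∃ (nr : ℕ) (R : Matrix (Fin nr) ι (Mero P)[X]), IsKernelRep μ R 𝔅 ∧ order R = l}

/-- The coefficients of a state-space representation with `nu` inputs, `ny` outputs and state
dimension `nx`. -/
structure SSRep {np : ℕ} (P : Set (Fin np → ℝ)) (nu ny nx : ℕ) where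
  A : Matrix (Fin nx) (Fin nx) (Mero P)
  B : Matrix (Fin nx) (Fin nu) (Mero P)
  C : Matrix (Fin ny) (Fin nx) (Mero P)
  D : Matrix (Fin ny) (Fin nu) (Mero P)

/-- `(M ⋄ p)(k)` for a matrix `M` over `ℛ(P)`. -/
def mdiamond {np : ℕ} {P : Set (Fin np → ℝ)} {m n : ℕ} (M : Matrix (Fin m) (Fin n) (Mero P))
    (p : ℤ → P) (k : ℤ) : Matrix (Fin m) (Fin n) ℝ :=
  M.map fun r => diamond r p k

/-- The manifest behaviour of a state-space representation: all `(w, p)`, `w = col(u, y)`, that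
admit a state trajectory `x` on `ℤ` with `q x = (A ⋄ p) x + (B ⋄ p) u`,
`y = (C ⋄ p) x + (D ⋄ p) u`. -/
def SSRep.manifest {np : ℕ} {P : Set (Fin np → ℝ)} {nu ny nx : ℕ} (S : SSRep P nu ny nx) :
    Behaviour P (Fin nu ⊕ Fin ny) :=
  {wp | ∃ x : ℤ → Fin nx → ℝ, ∀ k : ℤ,
    x (k + 1) = (mdiamond S.A wp.2 k).mulVec (x k) +
        (mdiamond S.B wp.2 k).mulVec (fun i => wp.1 k (Sum.inl i)) ∧
    (fun i => wp.1 k (Sum.inr i)) = (mdiamond S.C wp.2 k).mulVec (x k) +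
        (mdiamond S.D wp.2 k).mulVec (fun i => wp.1 k (Sum.inl i))}

/-- `S` is a state-space representation of `𝔅`: its manifest behaviour is `𝔅`, in the almost
everywhere sense. -/
def SSRep.Represents {np : ℕ} {P : Set (Fin np → ℝ)} {nu ny nx : ℕ} (S : SSRep P nu ny nx)
    (μ : Measure (ℤ → P)) (𝔅 : Behaviour P (Fin nu ⊕ Fin ny)) : Prop :=
  ∀ᵐ p ∂μ, ∀ w, (w, p) ∈ 𝔅 ↔ (w, p) ∈ S.manifest

/-- The minimal state dimension `n(𝔅)` among all state-space representations of `𝔅`. -/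
def minStateDim {np : ℕ} {P : Set (Fin np → ℝ)} {nu ny : ℕ} (μ : Measure (ℤ → P))
    (𝔅 : Behaviour P (Fin nu ⊕ Fin ny)) : ℕ :=
  sInf {nx | ∃ S : SSRep P nu ny nx, S.Represents μ 𝔅}

end LPV

end

/-! The dimension formula is a rank computation for the observability matrix of a good state-space
representation. Write `O i` for `S.obs i` and σ for the time shift on ℛ.

A representation of minimal dimension has two properties (`exists_minimal_rep`): `[A B]` has a right
inverse over ℛ, so every state has a predecessor, and finitely many `O i` have a joint left inverse.
If the first failed, the states could be confined to the image of `[A B]` (`exists_restricted_rep`);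
if the second failed, the unobservable states could be divided out (`exists_quotient_rep`). Either
way the dimension would drop.

Along a trajectory, y(k+i) is `O i` x(k) plus a combination of u(k), …, u(k+i). Substituted into a
row of degree < L, this gives a linear form in x(k) and u(k), …, u(k+L-1). These take all values
because every state has a predecessor, so the row is an annihilator iff all coefficients of the form
vanish: its output part lies in the left kernel of col(`O 0`, …, `O (L-1)`), and its input part is
determined by the output part. The dimension is therefore n_y L minus the rank of that matrix.

For L at least the lag the rank is full (`eq_zero_of_obs_mul_eq_zero`). A vector V killed by `O i`,
i < L, starts a trajectory with zero input from time 0 on, whose signal vanishes at times 0, …, L-1.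
Replacing its past by zero keeps it in 𝔅, since a kernel representation of order ≤ L sees only
windows of L+1 samples. The new signal has zero state in the past, hence zero state and output
forever, and V = 0 by observability. The lag is attained because eliminating the state of an
observable representation produces a kernel representation (`exists_isKernelRep`). -/

noncomputable section

namespace LPV

/-! ### Linear algebra over a field. -/

open Matrix in
/-- A subspace of row vectors has a basis, given as the rows of a right-invertible matrix. -/
theorem exists_rows_basis {F : Type*} [Field F] {n : ℕ} (W : Submodule F (Fin n → F)) :
    ∃ (r : ℕ) (M : Matrix (Fin r) (Fin n) F) (N : Matrix (Fin n) (Fin r) F),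
      M * N = 1 ∧ (W ≠ ⊤ → r < n) ∧ (∀ a, M a ∈ W) ∧ ∀ w ∈ W, ∃ c, w = c ᵥ* M := by
  let b := Module.finBasis F W
  let M : Matrix (Fin (Module.finrank F W)) (Fin n) F := fun a => (b a : Fin n → F)
  have hli : LinearIndependent F M.row :=
    b.linearIndependent.map' W.subtype W.ker_subtype
  have hinj : LinearMap.ker M.vecMulLinear = ⊥ :=
    LinearMap.ker_eq_bot.2 (Matrix.vecMul_injective_iff.2 hli)
  obtain ⟨g, hg⟩ := M.vecMulLinear.exists_leftInverse_of_injective hinj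
  refine ⟨_, M, Matrix.of fun i a => g (Pi.single i 1) a, ?_, fun hW => ?_, fun a => (b a).2,
    fun w hw => ⟨b.repr ⟨w, hw⟩, ?_⟩⟩
  · ext a c
    have h1 := congrFun (LinearMap.congr_fun hg (Pi.single a 1)) c
    have h2 : M.vecMulLinear (Pi.single a 1) = M a := by
      simp [Matrix.vecMulLinear]
      rfl
    rw [LinearMap.comp_apply, h2, LinearMap.id_apply] at h1
    rw [Matrix.one_apply, Matrix.mul_apply]
    simp only [Matrix.of_apply]
    have h3 : M a = ∑ i, M a i • (Pi.single i (1 : F) : Fin n → F) := by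
      ext j
      simp [Finset.sum_apply, Pi.single_apply]
    rw [h3, map_sum, Finset.sum_apply] at h1
    simp only [map_smul, Pi.smul_apply, smul_eq_mul] at h1
    rw [h1, Pi.single_apply]
    simp [eq_comm]
  · have := Submodule.finrank_lt hW
    simpa using this
  · have h1 := congrArg Subtype.val (b.sum_repr ⟨w, hw⟩)
    rw [AddSubmonoidClass.coe_finsetSum] at h1
    refine h1.symm.trans ?_
    rw [Matrix.vecMul_eq_sum]
    rfl

/-- A proper subspace of a coordinate space is annihilated by a non-zero vector. -/
theorem exists_dotProduct_eq_zero {F : Type*} [Field F] {n : ℕ} (W : Submodule F (Fin n → F))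
    (hW : W ≠ ⊤) : ∃ v : Fin n → F, v ≠ 0 ∧ ∀ w ∈ W, ∑ i, w i * v i = 0 := by
  obtain ⟨f, hf, hfW⟩ := Submodule.exists_le_ker_of_lt_top W (lt_top_iff_ne_top.2 hW)
  have hrep : ∀ w, f w = ∑ i, w i * f (Pi.single i 1) := fun w => by
    conv_lhs => rw [← Finset.univ_sum_single w]
    rw [map_sum]
    refine Finset.sum_congr rfl fun i _ => ?_
    rw [← smul_eq_mul, ← map_smul]
    congr 1
    ext j
    simp [Pi.single_apply]
  refine ⟨fun i => f (Pi.single i 1), fun h0 => hf ?_, fun w hw => (hrep w).symm.trans (hfW hw)⟩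
  ext i
  simpa using congrFun h0 i

/-- The kernel of a surjective linear map between finite-dimensional coordinate spaces. -/
theorem finrank_ker_of_surjective {F : Type*} [Field F] {V : Type*} [AddCommGroup V] [Module F V]
    [Module.Finite F V] {n : ℕ} (f : V →ₗ[F] Fin n → F) (hf : Function.Surjective f) :
    Module.Finite F (LinearMap.ker f) ∧
      Module.finrank F (LinearMap.ker f) + n = Module.finrank F V := by
  refine ⟨inferInstance, ?_⟩
  have := f.finrank_range_add_finrank_ker
  rw [LinearMap.range_eq_top.2 hf] at this
  simp at this
  omega

/-! ### Bi-infinite trajectories of time-varying linear systems over ℝ. -/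

/-- Two-sided construction of a bi-infinite sequence with prescribed one-step relations. -/
theorem exists_int_sequence {α : Type*} (good : ℤ → α → Prop) (r : ℤ → α → α → Prop) (x₀ : α)
    (h₀ : good 0 x₀) (hf : ∀ k, 0 ≤ k → ∀ v, good k v → ∃ v', good (k + 1) v' ∧ r k v v')
    (hb : ∀ k, k < 0 → ∀ v', good (k + 1) v' → ∃ v, good k v ∧ r k v v') :
    ∃ x : ℤ → α, x 0 = x₀ ∧ ∀ k, r k (x k) (x (k + 1)) := by
  -- Extended by a default value to points that are not good, so that `choose` yields total step
  -- functions.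
  have hf' : ∀ (n : ℕ) v, ∃ v', good n v → good (n + 1 : ℤ) v' ∧ r n v v' := fun n v => by
    by_cases h : good n v
    · obtain ⟨v', h'⟩ := hf n (by positivity) v h
      exact ⟨v', fun _ => h'⟩
    · exact ⟨v, fun h' => (h h').elim⟩
  have hb' : ∀ (n : ℕ) v', ∃ v, good (-n : ℤ) v' →
      good (-(n + 1 : ℕ) : ℤ) v ∧ r (-(n + 1 : ℕ) : ℤ) v v' := fun n v' => by
    by_cases h : good (-n : ℤ) v'
    · have e : (-(n + 1 : ℕ) : ℤ) + 1 = -n := by push_cast; ring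
      obtain ⟨v, h'⟩ := hb (-(n + 1 : ℕ) : ℤ) (by push_cast; omega) v' (by rwa [e])
      exact ⟨v, fun _ => h'⟩
    · exact ⟨v', fun h' => (h h').elim⟩
  choose f hf using hf'
  choose g hg using hb'
  let X : ℕ → α := fun n => Nat.rec x₀ (fun n v => f n v) n
  let Y : ℕ → α := fun n => Nat.rec x₀ (fun n v => g n v) n
  have hX : ∀ n : ℕ, good n (X n) := fun n => by
    induction n with
    | zero => exact h₀
    | succ n ih =>
      have := (hf n _ ih).1
      push_cast
      exact this
  have hY : ∀ n : ℕ, good (-n : ℤ) (Y n) := fun n => by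
    induction n with
    | zero => exact h₀
    | succ n ih => exact (hg n _ ih).1
  let x : ℤ → α := fun k => if 0 ≤ k then X k.toNat else Y (-k).toNat
  have hxX : ∀ n : ℕ, x n = X n := fun n => by simp [x]
  have hxY : ∀ n : ℕ, x (-n : ℤ) = Y n := fun n => by
    rcases n with _ | n
    · simp [x, X, Y]
    · have : ¬ (0 : ℤ) ≤ -((n + 1 : ℕ) : ℤ) := by push_cast; omega
      simp only [x, if_neg this, neg_neg, Int.toNat_natCast]
  refine ⟨x, hxX 0, fun k => ?_⟩
  rcases le_or_gt 0 k with hk | hk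
  · lift k to ℕ using hk
    have h1 : x ((k : ℤ) + 1) = X (k + 1) := by exact_mod_cast hxX (k + 1)
    rw [hxX, h1]
    exact (hf k _ (hX k)).2
  · obtain ⟨n, rfl⟩ : ∃ n : ℕ, k = -((n + 1 : ℕ) : ℤ) := ⟨(-k - 1).toNat, by omega⟩
    have e : (-(n + 1 : ℕ) : ℤ) + 1 = -n := by push_cast; ring
    rw [e, hxY, hxY]
    exact (hg n _ (hY n)).2

/-- The subspace of a linear time-varying system reached at time `k` after `m` steps. -/
def reachedImage {V : Type*} [AddCommGroup V] [Module ℝ V] (T : ℤ → V →ₗ[ℝ] V) :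
    ℕ → ℤ → Submodule ℝ V
  | 0, _ => ⊤
  | m + 1, k => (reachedImage T m (k - 1)).map (T (k - 1))

theorem reachedImage_antitone {V : Type*} [AddCommGroup V] [Module ℝ V] (T : ℤ → V →ₗ[ℝ] V)
    (m : ℕ) : ∀ k, reachedImage T (m + 1) k ≤ reachedImage T m k := by
  induction m with
  | zero => exact fun k => le_top
  | succ m ih => exact fun k => Submodule.map_mono (ih (k - 1))

/-- A point reached from arbitrarily far in the past lies on a bi-infinite trajectory. -/
theorem exists_trajectory_of_mem_reachedImage {V : Type*} [AddCommGroup V] [Module ℝ V]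
    [FiniteDimensional ℝ V] (T : ℤ → V →ₗ[ℝ] V) (x₀ : V) (h₀ : ∀ m, x₀ ∈ reachedImage T m 0) :
    ∃ x : ℤ → V, x 0 = x₀ ∧ ∀ k, x (k + 1) = T k (x k) := by
  have hstab : ∀ k, ∃ N, ∀ m, N ≤ m → reachedImage T N k = reachedImage T m k := fun k => by
    let f : ℕ →o (Submodule ℝ V)ᵒᵈ := ⟨fun m => OrderDual.toDual (reachedImage T m k),
      monotone_nat_of_le_succ fun m => reachedImage_antitone T m k⟩
    obtain ⟨N, hN⟩ := IsArtinian.monotone_stabilizes f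
    exact ⟨N, fun m hm => OrderDual.toDual.injective (hN m hm)⟩
  -- The good points at time k form the intersection of all reached subspaces; `T k` maps it onto
  -- the intersection at time k + 1.
  refine exists_int_sequence (fun k v => ∀ m, v ∈ reachedImage T m k)
    (fun k v v' => v' = T k v) x₀ h₀ (fun k _ v hv => ⟨T k v, fun m => ?_, rfl⟩)
    fun k _ v' hv' => ?_
  · rcases m with _ | m
    · exact Submodule.mem_top
    · refine ⟨v, ?_, ?_⟩ <;> simp [hv]
  · obtain ⟨N, hN⟩ := hstab k
    obtain ⟨v, hv, hvv'⟩ := hv' (N + 1)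
    rw [add_sub_cancel_right] at hv hvv'
    refine ⟨v, fun m => ?_, hvv'.symm⟩
    rcases le_total N m with hm | hm
    · exact hN m hm ▸ hv
    · exact antitone_nat_of_succ_le (f := fun m => reachedImage T m k)
        (fun m => reachedImage_antitone T m k) hm hv

/-- An inhomogeneous linear time-varying difference equation on `ℤ` has a solution. -/
theorem exists_inhomogeneous_solution {V : Type*} [AddCommGroup V] [Module ℝ V]
    [FiniteDimensional ℝ V] (T : ℤ → V →ₗ[ℝ] V) (f : ℤ → V) :
    ∃ x : ℤ → V, ∀ k, x (k + 1) = T k (x k) + f k := by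
  -- The affine recursion becomes linear on `V × ℝ`, where the last coordinate stays constant and
  -- will be 1.
  let T' : ℤ → V × ℝ →ₗ[ℝ] V × ℝ := fun k =>
    LinearMap.prod (LinearMap.coprod (T k) (LinearMap.toSpanSingleton ℝ V (f k)))
      (LinearMap.snd ℝ V ℝ)
  have hone : ∀ m k, ∃ v, (v, (1 : ℝ)) ∈ reachedImage T' m k := fun m => by
    induction m with
    | zero => exact fun k => ⟨0, Submodule.mem_top⟩
    | succ m ih =>
      intro k
      obtain ⟨v, hv⟩ := ih (k - 1)
      exact ⟨T (k - 1) v + f (k - 1), (v, 1), hv, by simp [T']⟩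
  obtain ⟨N, hN⟩ : ∃ N, ∀ m, N ≤ m → reachedImage T' N 0 = reachedImage T' m 0 := by
    let g : ℕ →o (Submodule ℝ (V × ℝ))ᵒᵈ := ⟨fun m => OrderDual.toDual (reachedImage T' m 0),
      monotone_nat_of_le_succ fun m => reachedImage_antitone T' m 0⟩
    obtain ⟨N, hN⟩ := IsArtinian.monotone_stabilizes g
    exact ⟨N, fun m hm => OrderDual.toDual.injective (hN m hm)⟩
  -- Stationarity at time 0 puts one and the same `(v, 1)` into all reached subspaces.
  obtain ⟨v, hv⟩ := hone N 0
  obtain ⟨x, hx0, hx⟩ := exists_trajectory_of_mem_reachedImage T' (v, 1) fun m => by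
    rcases le_total N m with hm | hm
    · exact hN m hm ▸ hv
    · exact antitone_nat_of_succ_le (f := fun m => reachedImage T' m 0)
        (fun m => reachedImage_antitone T' m 0) hm hv
  have hsnd : ∀ k, (x (k + 1)).2 = (x k).2 := fun k => by rw [hx]; rfl
  have h1 : ∀ k, (x k).2 = 1 := fun k => by
    induction k using Int.induction_on with
    | zero => rw [hx0]
    | succ i ih => rw [hsnd, ih]
    | pred i ih => rw [← hsnd, sub_add_cancel, ih]
  refine ⟨fun k => (x k).1, fun k => ?_⟩
  have h2 : (x (k + 1)).1 = T k (x k).1 + (x k).2 • f k := by rw [hx]; rfl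
  simpa only [h1, one_smul] using h2

/-! ### The shift on ℛ, and evaluation along almost every scheduling signal. -/

variable {np : ℕ} {P : Set (Fin np → ℝ)}

theorem shift_shift {α : Type*} (k l : ℤ) (p : ℤ → α) : shift k (shift l p) = shift (k + l) p := by
  funext i
  simp [shift, add_assoc]

theorem shift_zero {α : Type*} (p : ℤ → α) : shift 0 p = p := by
  funext i
  simp [shift]

/-- Time shift of analytic functions of finitely many samples. -/
def analyticShift (P : Set (Fin np → ℝ)) (k : ℤ) : AnalyticDep P →+* AnalyticDep P where
  toFun f := ⟨fun p => f.1 (shift k p), f.2.comp_shift k⟩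
  map_one' := rfl
  map_mul' _ _ := rfl
  map_zero' := rfl
  map_add' _ _ := rfl

/-- The shift by k is inverted by the shift by -k, so it preserves non-zero-divisors; this is what
extends it to fractions. -/
theorem analyticShift_mem_nonZeroDivisors (k : ℤ) :
    nonZeroDivisors (AnalyticDep P) ≤
      (nonZeroDivisors (AnalyticDep P)).comap (analyticShift P k) := by
  intro h hh
  have hinv : ∀ x : AnalyticDep P, analyticShift P k (analyticShift P (-k) x) = x := fun x => by
    ext p
    change x.1 (shift (-k) (shift k p)) = x.1 p
    rw [shift_shift, neg_add_cancel, shift_zero]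
  have hinv' : ∀ x : AnalyticDep P, analyticShift P (-k) (analyticShift P k x) = x := fun x => by
    ext p
    change x.1 (shift k (shift (-k) p)) = x.1 p
    rw [shift_shift, add_neg_cancel, shift_zero]
  rw [Submonoid.mem_comap, mem_nonZeroDivisors_iff_right]
  intro x hx
  have h1 : analyticShift P (-k) x * h = 0 := by
    rw [← hinv' h, ← map_mul, hx, map_zero]
  have h2 := mem_nonZeroDivisors_iff_right.1 hh _ h1
  rw [← hinv x, h2, map_zero]

/-- The time shift `σᵏ` on `ℛ(P)`. -/
def meroShift (P : Set (Fin np → ℝ)) (k : ℤ) : Mero P →+* Mero P :=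
  IsLocalization.map (Mero P) (analyticShift P k) (analyticShift_mem_nonZeroDivisors k)

variable {μ : Measure (ℤ → P)}

theorem IsAdmissible.ae_diamond_meroShift (hμ : IsAdmissible μ) (c : ℤ) (r : Mero P) :
    ∀ᵐ p ∂μ, ∀ k, diamond (meroShift P c r) p k = diamond r p (k + c) := by
  obtain ⟨g, h, rfl⟩ := IsLocalization.exists_mk'_eq (nonZeroDivisors (AnalyticDep P)) r
  filter_upwards [hμ.ae_shift_ne_zero h] with p hp k
  rw [meroShift, IsLocalization.map_mk', diamond, diamond, eval_mk' _ _ _ (hp (k + c))]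
  have e : shift c (shift k p) = shift (k + c) p := by rw [shift_shift, add_comm]
  rw [eval_mk']
  · change g.1 (shift c (shift k p)) / h.1.1 (shift c (shift k p)) = _
    rw [e]
  · change h.1.1 (shift c (shift k p)) ≠ 0
    rw [e]
    exact hp _

theorem diamond_zero (p : ℤ → P) (k : ℤ) : diamond (0 : Mero P) p k = 0 := eval_zero _

theorem diamond_one (p : ℤ → P) (k : ℤ) : diamond (1 : Mero P) p k = 1 := by
  have h := eval_mk' (P := P) 1 1 (shift k p) one_ne_zero
  rw [IsLocalization.mk'_one, map_one] at h
  exact h.trans (div_one _)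

theorem IsAdmissible.ae_diamond_sum (hμ : IsAdmissible μ) {ι : Type*} (s : Finset ι)
    (f : ι → Mero P) :
    ∀ᵐ p ∂μ, ∀ k, diamond (∑ i ∈ s, f i) p k = ∑ i ∈ s, diamond (f i) p k := by
  classical
  induction s using Finset.induction_on with
  | empty => exact Filter.Eventually.of_forall fun p k => by simp [diamond_zero]
  | insert a s ha ih =>
    filter_upwards [ih, hμ.ae_diamond_add (f a) (∑ i ∈ s, f i)] with p h1 h2 k
    rw [Finset.sum_insert ha, Finset.sum_insert ha, h2, h1]

/-- The way back from almost everywhere statements to ℛ. Numerator and denominator of a non-zero r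
are non-zero almost everywhere, and μ ≠ 0 leaves some p at which the value is then non-zero; time 0
suffices. -/
theorem IsAdmissible.eq_zero_of_ae_diamond (hμ : IsAdmissible μ) (r : Mero P)
    (hr : ∀ᵐ p ∂μ, diamond r p 0 = 0) : r = 0 := by
  obtain ⟨g, h, rfl⟩ := IsLocalization.exists_mk'_eq (nonZeroDivisors (AnalyticDep P)) r
  by_contra hne
  have hg : g ≠ 0 := by
    rintro rfl
    exact hne (IsLocalization.mk'_zero h)
  have hbot : ∀ᵐ _ ∂μ, False := by
    filter_upwards [hμ.ae_shift_ne_zero h, hμ.ae_ne_zero g hg, hr] with p h1 h2 h3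
    have h4 := h1 0
    rw [diamond, eval_mk' _ _ _ h4, shift_zero] at h3
    rw [shift_zero] at h4
    exact (div_ne_zero h2 h4) h3
  exact hμ.ne_zero (by simpa using hbot)

theorem IsAdmissible.ae_mdiamond_mul (hμ : IsAdmissible μ) {l m n : ℕ}
    (M : Matrix (Fin l) (Fin m) (Mero P)) (N : Matrix (Fin m) (Fin n) (Mero P)) :
    ∀ᵐ p ∂μ, ∀ k, mdiamond (M * N) p k = mdiamond M p k * mdiamond N p k := by
  have h1 : ∀ᵐ p ∂μ, ∀ i j a k,
      diamond (M i a * N a j) p k = diamond (M i a) p k * diamond (N a j) p k :=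
    ae_all_iff.2 fun i => ae_all_iff.2 fun j => ae_all_iff.2 fun a => hμ.ae_diamond_mul _ _
  have h2 : ∀ᵐ p ∂μ, ∀ i j k,
      diamond (∑ a, M i a * N a j) p k = ∑ a, diamond (M i a * N a j) p k :=
    ae_all_iff.2 fun i => ae_all_iff.2 fun j => hμ.ae_diamond_sum _ _
  filter_upwards [h1, h2] with p h1 h2 k
  ext i j
  simp only [mdiamond, Matrix.map_apply, Matrix.mul_apply, h2, h1]

theorem IsAdmissible.ae_mdiamond_add (hμ : IsAdmissible μ) {m n : ℕ}
    (M N : Matrix (Fin m) (Fin n) (Mero P)) :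
    ∀ᵐ p ∂μ, ∀ k, mdiamond (M + N) p k = mdiamond M p k + mdiamond N p k := by
  have h1 : ∀ᵐ p ∂μ, ∀ i j k,
      diamond (M i j + N i j) p k = diamond (M i j) p k + diamond (N i j) p k :=
    ae_all_iff.2 fun i => ae_all_iff.2 fun j => hμ.ae_diamond_add _ _
  filter_upwards [h1] with p h1 k
  ext i j
  simp only [mdiamond, Matrix.map_apply, Matrix.add_apply, h1]

theorem IsAdmissible.ae_mdiamond_sub (hμ : IsAdmissible μ) {m n : ℕ}
    (M N : Matrix (Fin m) (Fin n) (Mero P)) :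
    ∀ᵐ p ∂μ, ∀ k, mdiamond (M - N) p k = mdiamond M p k - mdiamond N p k := by
  filter_upwards [hμ.ae_mdiamond_add (M - N) N] with p hp k
  rw [eq_sub_iff_add_eq, ← hp, sub_add_cancel]

theorem mdiamond_zero {m n : ℕ} (p : ℤ → P) (k : ℤ) :
    mdiamond (0 : Matrix (Fin m) (Fin n) (Mero P)) p k = 0 := by
  ext i j
  simp [mdiamond, diamond_zero]

theorem mdiamond_one {n : ℕ} (p : ℤ → P) (k : ℤ) :
    mdiamond (1 : Matrix (Fin n) (Fin n) (Mero P)) p k = 1 := by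
  ext i j
  by_cases h : i = j <;> simp [mdiamond, diamond_zero, diamond_one, Matrix.one_apply, h]

theorem IsAdmissible.ae_mdiamond_sum (hμ : IsAdmissible μ) {m n : ℕ} {ι : Type*} (s : Finset ι)
    (f : ι → Matrix (Fin m) (Fin n) (Mero P)) :
    ∀ᵐ p ∂μ, ∀ k, mdiamond (∑ i ∈ s, f i) p k = ∑ i ∈ s, mdiamond (f i) p k := by
  classical
  induction s using Finset.induction_on with
  | empty => exact Filter.Eventually.of_forall fun p k => by simp [mdiamond_zero]
  | insert a s ha ih =>
    filter_upwards [ih, hμ.ae_mdiamond_add (f a) (∑ i ∈ s, f i)] with p h1 h2 k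
    rw [Finset.sum_insert ha, Finset.sum_insert ha, h2, h1]

/-- The time shift `σᵏ` on matrices over `ℛ(P)`. -/
def mshift (k : ℤ) {m n : ℕ} (M : Matrix (Fin m) (Fin n) (Mero P)) :
    Matrix (Fin m) (Fin n) (Mero P) :=
  M.map (meroShift P k)

theorem IsAdmissible.ae_mdiamond_mshift (hμ : IsAdmissible μ) (c : ℤ) {m n : ℕ}
    (M : Matrix (Fin m) (Fin n) (Mero P)) :
    ∀ᵐ p ∂μ, ∀ k, mdiamond (mshift c M) p k = mdiamond M p (k + c) := by
  have h1 : ∀ᵐ p ∂μ, ∀ i j k,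
      diamond (meroShift P c (M i j)) p k = diamond (M i j) p (k + c) :=
    ae_all_iff.2 fun i => ae_all_iff.2 fun j => hμ.ae_diamond_meroShift c _
  filter_upwards [h1] with p h1 k
  ext i j
  simp only [mdiamond, mshift, Matrix.map_apply, h1]

/-! ### Reduction to a minimal state-space representation. -/

/-- Either `[A B]` has a right inverse, or it factors through a smaller dimension. -/
theorem right_inverse_or_factor_of_field {F : Type*} [Field F] {m k l : ℕ}
    (A : Matrix (Fin m) (Fin k) F) (B : Matrix (Fin m) (Fin l) F) :
    (∃ (E : Matrix (Fin k) (Fin m) F) (G : Matrix (Fin l) (Fin m) F), A * E + B * G = 1) ∨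
      ∃ r < m, ∃ (N : Matrix (Fin m) (Fin r) F)
      (A₁ : Matrix (Fin r) (Fin k) F) (B₁ : Matrix (Fin r) (Fin l) F), A = N * A₁ ∧ B = N * B₁ := by
  let f := A.mulVecLin.coprod B.mulVecLin
  by_cases hW : LinearMap.range f = ⊤
  · left
    rw [LinearMap.range_eq_top] at hW
    choose g hg using fun i => hW (Pi.single i 1)
    refine ⟨Matrix.of fun a i => (g i).1 a, Matrix.of fun a i => (g i).2 a, ?_⟩
    ext i j
    have h1 := congrFun (hg j) i
    simpa [f, Matrix.mulVec, dotProduct, Matrix.mul_apply, Matrix.one_apply, Pi.single_apply]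
      using h1
  · right
    -- The rows of `M` are a basis of the column space of `[A B]`, so its transpose serves as `N`.
    obtain ⟨r, M, -, -, hr, -, hM⟩ := exists_rows_basis (LinearMap.range f)
    have hA : ∀ j, (fun i => A i j) ∈ LinearMap.range f := fun j =>
      ⟨(Pi.single j 1, 0), by ext i; simp [f]⟩
    have hB : ∀ j, (fun i => B i j) ∈ LinearMap.range f := fun j =>
      ⟨(0, Pi.single j 1), by ext i; simp [f]⟩
    choose α hα using fun j => hM _ (hA j)
    choose β hβ using fun j => hM _ (hB j)
    refine ⟨r, hr hW, M.transpose, Matrix.of fun a j => α j a, Matrix.of fun a j => β j a, ?_, ?_⟩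
    · ext i j
      have := congrFun (hα j) i
      simpa [Matrix.vecMul, dotProduct, Matrix.mul_apply, mul_comm] using this
    · ext i j
      have := congrFun (hβ j) i
      simpa [Matrix.vecMul, dotProduct, Matrix.mul_apply, mul_comm] using this

/-- `Mero P` carries only a ring structure, with `IsField` as a fact about it; the field version is
applied to the field structure built on that same ring. -/
theorem right_inverse_or_factor {F : Type*} [CommRing F] (hF : IsField F) {m k l : ℕ}
    (A : Matrix (Fin m) (Fin k) F) (B : Matrix (Fin m) (Fin l) F) :
    (∃ (E : Matrix (Fin k) (Fin m) F) (G : Matrix (Fin l) (Fin m) F), A * E + B * G = 1) ∨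
      ∃ r < m, ∃ (N : Matrix (Fin m) (Fin r) F)
      (A₁ : Matrix (Fin r) (Fin k) F) (B₁ : Matrix (Fin r) (Fin l) F), A = N * A₁ ∧ B = N * B₁ :=
  @right_inverse_or_factor_of_field F hF.toField m k l A B

/-- Either finitely many of the matrices `O i` have a joint left inverse, or all of them factor
through a smaller dimension. -/
theorem left_inverse_or_factor_of_field {F : Type*} [Field F] {m n : ℕ}
    (O : ℕ → Matrix (Fin m) (Fin n) F) :
    (∃ (K : ℕ) (G : ℕ → Matrix (Fin n) (Fin m) F), ∑ i ∈ Finset.range K, G i * O i = 1) ∨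
      ∃ r < n, ∃ (M : Matrix (Fin r) (Fin n) F) (N : Matrix (Fin n) (Fin r) F), M * N = 1 ∧
        (∀ i, ∃ C : Matrix (Fin m) (Fin r) F, O i = C * M) ∧
        ∃ (K : ℕ) (H : ℕ → Matrix (Fin r) (Fin m) F), M = ∑ i ∈ Finset.range K, H i * O i := by
  let f : (ℕ →₀ (Fin m → F)) →ₗ[F] Fin n → F := Finsupp.lsum F fun i => (O i).vecMulLinear
  have hcomb : ∀ (r : ℕ) (M : Matrix (Fin r) (Fin n) F), (∀ a, M a ∈ LinearMap.range f) →
      ∃ (K : ℕ) (H : ℕ → Matrix (Fin r) (Fin m) F), M = ∑ i ∈ Finset.range K, H i * O i := by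
    intro r M hM
    choose g hg using hM
    -- A bound beyond the supports of the finitely many combinations that give the rows of `M`.
    refine ⟨Finset.univ.sup (fun a => (g a).support.sup id) + 1,
      fun i => Matrix.of fun a => g a i, ?_⟩
    ext a j
    have h1 : (g a).support ⊆
        Finset.range (Finset.univ.sup (fun a => (g a).support.sup id) + 1) := fun i hi =>
      Finset.mem_range.2 (Nat.lt_succ_of_le ((Finset.le_sup (f := id) hi).trans
        (Finset.le_sup (f := fun a => (g a).support.sup id) (Finset.mem_univ a))))
    rw [← hg a]
    simp only [f, Finsupp.lsum_apply]
    rw [Finsupp.sum_of_support_subset _ h1 _ (by simp)]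
    simp [Finset.sum_apply, Matrix.sum_apply, Matrix.mul_apply, Matrix.vecMul, dotProduct]
  by_cases hW : LinearMap.range f = ⊤
  · left
    obtain ⟨K, H, h⟩ := hcomb n 1 fun a => hW ▸ Submodule.mem_top
    exact ⟨K, H, h.symm⟩
  · right
    obtain ⟨r, M, N, hMN, hr, hMr, hM⟩ := exists_rows_basis (LinearMap.range f)
    refine ⟨r, hr hW, M, N, hMN, fun i => ?_, hcomb r M hMr⟩
    have hO : ∀ a, O i a ∈ LinearMap.range f := fun a =>
      ⟨Finsupp.single i (Pi.single a 1), by ext j; simp [f]⟩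
    choose c hc using fun a => hM _ (hO a)
    refine ⟨Matrix.of c, ?_⟩
    ext a j
    have := congrFun (hc a) j
    simpa [Matrix.vecMul, dotProduct, Matrix.mul_apply] using this

theorem left_inverse_or_factor {F : Type*} [CommRing F] (hF : IsField F) {m n : ℕ}
    (O : ℕ → Matrix (Fin m) (Fin n) F) :
    (∃ (K : ℕ) (G : ℕ → Matrix (Fin n) (Fin m) F), ∑ i ∈ Finset.range K, G i * O i = 1) ∨
      ∃ r < n, ∃ (M : Matrix (Fin r) (Fin n) F) (N : Matrix (Fin n) (Fin r) F), M * N = 1 ∧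
        (∀ i, ∃ C : Matrix (Fin m) (Fin r) F, O i = C * M) ∧
        ∃ (K : ℕ) (H : ℕ → Matrix (Fin r) (Fin m) F), M = ∑ i ∈ Finset.range K, H i * O i :=
  @left_inverse_or_factor_of_field F hF.toField m n O

variable {nu ny nx : ℕ}

/-- Restricting a state-space representation to the states that have a predecessor. -/
theorem exists_restricted_rep (hμ : IsAdmissible μ) (S : SSRep P nu ny nx) {r : ℕ}
    (N : Matrix (Fin nx) (Fin r) (Mero P)) (A₁ : Matrix (Fin r) (Fin nx) (Mero P))
    (B₁ : Matrix (Fin r) (Fin nu) (Mero P)) (hA : S.A = N * A₁) (hB : S.B = N * B₁) :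
    ∃ S' : SSRep P nu ny r, ∀ᵐ p ∂μ, ∀ w, (w, p) ∈ S.manifest ↔ (w, p) ∈ S'.manifest := by
  -- The new state z(k+1) = A₁ x(k) + B₁ u(k) satisfies x(k+1) = N(k) z(k+1); hence x(k) = N(k-1)
  -- z(k), which accounts for the shift by -1.
  refine ⟨⟨A₁ * mshift (-1) N, B₁, S.C * mshift (-1) N, S.D⟩, ?_⟩
  filter_upwards [hμ.ae_mdiamond_mul N A₁, hμ.ae_mdiamond_mul N B₁,
    hμ.ae_mdiamond_mul A₁ (mshift (-1) N), hμ.ae_mdiamond_mul S.C (mshift (-1) N),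
    hμ.ae_mdiamond_mshift (-1) N] with p h1 h2 h3 h4 h5 w
  rw [← hA] at h1
  rw [← hB] at h2
  simp only [SSRep.manifest, Set.mem_ofPred_eq, h3, h4, h5, h1, h2]
  constructor
  · rintro ⟨x, hx⟩
    let z : ℤ → Fin r → ℝ := fun k => (mdiamond A₁ p (k + -1)).mulVec (x (k + -1)) +
        (mdiamond B₁ p (k + -1)).mulVec (fun i => w (k + -1) (Sum.inl i))
    have hz : ∀ k, x k = (mdiamond N p (k + -1)).mulVec (z k) := fun k => by
      have := (hx (k + -1)).1
      rw [neg_add_cancel_right] at this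
      rw [this]
      simp only [z, Matrix.mulVec_add, Matrix.mulVec_mulVec]
    refine ⟨z, fun k => ⟨?_, ?_⟩⟩
    · rw [← Matrix.mulVec_mulVec, ← hz]
      simp only [z, add_neg_cancel_right]
    · rw [← Matrix.mulVec_mulVec, ← hz]
      exact (hx k).2
  · rintro ⟨z, hz⟩
    refine ⟨fun k => (mdiamond N p (k + -1)).mulVec (z k), fun k => ⟨?_, ?_⟩⟩
    · beta_reduce
      rw [add_neg_cancel_right, (hz k).1]
      simp only [Matrix.mulVec_add, Matrix.mulVec_mulVec, Matrix.mul_assoc]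
    · rw [Matrix.mulVec_mulVec]
      exact (hz k).2

/-- State trajectories lift along a quotient of the state space. -/
theorem exists_state_lift {n r m : ℕ} (a : ℤ → Matrix (Fin n) (Fin n) ℝ)
    (b : ℤ → Matrix (Fin n) (Fin m) ℝ) (a' : ℤ → Matrix (Fin r) (Fin r) ℝ)
    (M : ℤ → Matrix (Fin r) (Fin n) ℝ) (N : ℤ → Matrix (Fin n) (Fin r) ℝ)
    (hMN : ∀ k, M k * N k = 1) (hMa : ∀ k, M (k + 1) * a k = a' k * M k) (u : ℤ → Fin m → ℝ)
    (x' : ℤ → Fin r → ℝ)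
    (hx' : ∀ k, x' (k + 1) = (a' k).mulVec (x' k) + (M (k + 1) * b k).mulVec (u k)) :
    ∃ x : ℤ → Fin n → ℝ, (∀ k, (M k).mulVec (x k) = x' k) ∧
      ∀ k, x (k + 1) = (a k).mulVec (x k) + (b k).mulVec (u k) := by
  -- The lift is sought as x = N x' + e with M e = 0; `f` is the defect of N x' in the state
  -- equation.
  let f : ℤ → Fin n → ℝ := fun k => (a k).mulVec ((N k).mulVec (x' k)) + (b k).mulVec (u k) -
    (N (k + 1)).mulVec (x' (k + 1))
  -- The factor 1 - N M in front of a, together with M f = 0, forces M e = 0 at every time. On such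
  -- e it changes nothing, because M a e = a' M e = 0. As a may be singular, solvability backward in
  -- time is not automatic.
  obtain ⟨e, he⟩ := exists_inhomogeneous_solution
    (fun k => (a k - N (k + 1) * (M (k + 1) * a k)).mulVecLin) f
  simp only [Matrix.mulVecLin_apply] at he
  have hMf : ∀ k, (M (k + 1)).mulVec (f k) = 0 := fun k => by
    simp only [f, Matrix.mulVec_sub, Matrix.mulVec_add, Matrix.mulVec_mulVec]
    rw [hMN, ← Matrix.mul_assoc, hMa, Matrix.mul_assoc (a' k), hMN, Matrix.mul_one, Matrix.one_mulVec, hx', sub_self]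
  have hMe : ∀ k, (M (k + 1)).mulVec (e (k + 1)) = 0 := fun k => by
    rw [he, Matrix.mulVec_add, hMf, Matrix.mulVec_mulVec, Matrix.mul_sub, ← Matrix.mul_assoc,
      ← Matrix.mul_assoc, hMN, Matrix.one_mul, sub_self, Matrix.zero_mulVec, add_zero]
  have hMe' : ∀ k, (M k).mulVec (e k) = 0 := fun k => by
    have := hMe (k - 1)
    rwa [sub_add_cancel] at this
  refine ⟨fun k => (N k).mulVec (x' k) + e k, fun k => ?_, fun k => ?_⟩
  · rw [Matrix.mulVec_add, hMe', Matrix.mulVec_mulVec, hMN, Matrix.one_mulVec, add_zero]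
  · beta_reduce
    rw [he, Matrix.sub_mulVec, hMa, ← Matrix.mulVec_mulVec, ← Matrix.mulVec_mulVec, hMe',
      Matrix.mulVec_zero, Matrix.mulVec_zero, Matrix.mulVec_add]
    simp only [f]
    abel

/-- Factoring a state-space representation by its unobservable states. -/
theorem exists_quotient_rep (hμ : IsAdmissible μ) (S : SSRep P nu ny nx) {r : ℕ}
    (M : Matrix (Fin r) (Fin nx) (Mero P)) (N : Matrix (Fin nx) (Fin r) (Mero P))
    (hMN : M * N = 1) (A' : Matrix (Fin r) (Fin r) (Mero P)) (hA : mshift 1 M * S.A = A' * M)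
    (C' : Matrix (Fin ny) (Fin r) (Mero P)) (hC : S.C = C' * M) :
    ∃ S' : SSRep P nu ny r, ∀ᵐ p ∂μ, ∀ w, (w, p) ∈ S.manifest ↔ (w, p) ∈ S'.manifest := by
  refine ⟨⟨A', mshift 1 M * S.B, C', S.D⟩, ?_⟩
  filter_upwards [hμ.ae_mdiamond_mul M N, hμ.ae_mdiamond_mul (mshift 1 M) S.A,
    hμ.ae_mdiamond_mul A' M, hμ.ae_mdiamond_mul C' M, hμ.ae_mdiamond_mul (mshift 1 M) S.B,
    hμ.ae_mdiamond_mshift 1 M] with p h1 h2 h3 h4 h5 h6 w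
  rw [hMN] at h1
  rw [hA] at h2
  rw [← hC] at h4
  simp only [h6, mdiamond_one] at h1 h2 h5
  have hMa : ∀ k, mdiamond M p (k + 1) * mdiamond S.A p k = mdiamond A' p k * mdiamond M p k :=
    fun k => by rw [← h2, h3]
  simp only [SSRep.manifest, Set.mem_ofPred_eq, h5, h4]
  constructor
  · rintro ⟨x, hx⟩
    refine ⟨fun k => (mdiamond M p k).mulVec (x k), fun k => ⟨?_, ?_⟩⟩
    · beta_reduce
      rw [(hx k).1]
      simp only [Matrix.mulVec_add, Matrix.mulVec_mulVec, hMa]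
    · rw [Matrix.mulVec_mulVec]
      exact (hx k).2
  · rintro ⟨x', hx'⟩
    obtain ⟨x, hMx, hx⟩ := exists_state_lift (fun k => mdiamond S.A p k)
      (fun k => mdiamond S.B p k) (fun k => mdiamond A' p k) (fun k => mdiamond M p k)
      (fun k => mdiamond N p k) (fun k => (h1 k).symm) hMa (fun k i => w k (Sum.inl i)) x'
      fun k => (hx' k).1
    refine ⟨x, fun k => ⟨hx k, ?_⟩⟩
    rw [← Matrix.mulVec_mulVec, hMx]
    exact (hx' k).2

/-- The observability matrices: `O 0 = C` and `O (i + 1) = σ(O i) A`. -/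
def SSRep.obs (S : SSRep P nu ny nx) : ℕ → Matrix (Fin ny) (Fin nx) (Mero P)
  | 0 => S.C
  | i + 1 => mshift 1 (S.obs i) * S.A

theorem mshift_mul (k : ℤ) {l m n : ℕ} (M : Matrix (Fin l) (Fin m) (Mero P))
    (N : Matrix (Fin m) (Fin n) (Mero P)) : mshift k (M * N) = mshift k M * mshift k N :=
  Matrix.map_mul

theorem mshift_sum (k : ℤ) {m n : ℕ} {ι : Type*} (s : Finset ι)
    (f : ι → Matrix (Fin m) (Fin n) (Mero P)) :
    mshift k (∑ i ∈ s, f i) = ∑ i ∈ s, mshift k (f i) :=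
  map_sum (meroShift P k).toAddMonoidHom.mapMatrix f s

/-- A behaviour with a state-space representation has one of minimal dimension, in which every
state has a predecessor and which is observable. -/
theorem exists_minimal_rep (hPo : IsOpen P) (hPc : IsConnected P) (hμ : IsAdmissible μ)
    (𝔅 : Behaviour P (Fin nu ⊕ Fin ny)) (S₀ : SSRep P nu ny nx) (hS₀ : S₀.Represents μ 𝔅) :
    ∃ S : SSRep P nu ny (minStateDim μ 𝔅), S.Represents μ 𝔅 ∧
      (∃ (E : Matrix (Fin (minStateDim μ 𝔅)) (Fin (minStateDim μ 𝔅)) (Mero P))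
        (G : Matrix (Fin nu) (Fin (minStateDim μ 𝔅)) (Mero P)), S.A * E + S.B * G = 1) ∧
      ∃ (K : ℕ) (G : ℕ → Matrix (Fin (minStateDim μ 𝔅)) (Fin ny) (Mero P)),
        ∑ i ∈ Finset.range K, G i * S.obs i = 1 := by
  have hF := isField_mero hPo hPc
  obtain ⟨S, hS⟩ := Nat.sInf_mem (⟨nx, S₀, hS₀⟩ :
    {nx | ∃ S : SSRep P nu ny nx, S.Represents μ 𝔅}.Nonempty)
  change SSRep P nu ny (minStateDim μ 𝔅) at S
  have hmin : ∀ r, r < minStateDim μ 𝔅 → ¬ ∃ S' : SSRep P nu ny r,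
      ∀ᵐ p ∂μ, ∀ w, (w, p) ∈ S.manifest ↔ (w, p) ∈ S'.manifest := by
    rintro r hr ⟨S', hS'⟩
    refine Nat.notMem_of_lt_sInf hr ⟨S', ?_⟩
    filter_upwards [hS, hS'] with p h1 h2 w
    exact (h1 w).trans (h2 w)
  refine ⟨S, hS, ?_, ?_⟩
  · refine (right_inverse_or_factor hF S.A S.B).resolve_right ?_
    rintro ⟨r, hr, N, A₁, B₁, hA, hB⟩
    exact hmin r hr (exists_restricted_rep hμ S N A₁ B₁ hA hB)
  · refine (left_inverse_or_factor hF S.obs).resolve_right ?_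
    rintro ⟨r, hr, M, N, hMN, hO, K, H, hM⟩
    choose C hC using hO
    -- The row space of all `O i` is stable under v ↦ σ(v) A, since `O (i + 1)` = σ(`O i`) A.
    -- Applying this map to M = ∑ H i `O i` and using `O (i + 1)` = C (i + 1) M gives `A'`.
    refine hmin r hr (exists_quotient_rep hμ S M N hMN
      (∑ i ∈ Finset.range K, mshift 1 (H i) * C (i + 1)) ?_ (C 0) (hC 0))
    conv_lhs => rw [hM]
    rw [mshift_sum, Matrix.sum_mul, Matrix.sum_mul]
    refine Finset.sum_congr rfl fun i _ => ?_
    rw [mshift_mul, Matrix.mul_assoc, Matrix.mul_assoc, ← hC]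
    rfl

/-! ### Outputs in terms of state and inputs. -/

/-- The impulse response matrices: along a trajectory,
`y(k + i) = (O i ⋄ p)(k) x(k) + ∑ j ≤ i, (imp i j ⋄ p)(k) u(k + j)`. -/
def SSRep.imp (S : SSRep P nu ny nx) : ℕ → ℕ → Matrix (Fin ny) (Fin nu) (Mero P)
  | 0, 0 => S.D
  | 0, _ + 1 => 0
  | i + 1, 0 => mshift 1 (S.obs i) * S.B
  | i + 1, j + 1 => mshift 1 (S.imp i j)

/-- Causality. It makes the truncation bound in `resid` irrelevant as soon as it exceeds i. -/
theorem SSRep.imp_eq_zero (S : SSRep P nu ny nx) : ∀ {i j : ℕ}, i < j → S.imp i j = 0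
  | 0, 0, h => absurd h (lt_irrefl 0)
  | 0, _ + 1, _ => rfl
  | i + 1, j + 1, h => by
    rw [SSRep.imp, S.imp_eq_zero (Nat.lt_of_succ_lt_succ h)]
    ext a b
    simp [mshift]

/-- `x` is a state trajectory of `S` for the signal `w`. -/
def SSRep.IsTraj (S : SSRep P nu ny nx) (p : ℤ → P) (w : ℤ → Fin nu ⊕ Fin ny → ℝ)
    (x : ℤ → Fin nx → ℝ) : Prop :=
  ∀ k : ℤ, x (k + 1) = (mdiamond S.A p k).mulVec (x k) +
      (mdiamond S.B p k).mulVec (fun i => w k (Sum.inl i)) ∧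
    (fun i => w k (Sum.inr i)) = (mdiamond S.C p k).mulVec (x k) +
      (mdiamond S.D p k).mulVec (fun i => w k (Sum.inl i))

theorem SSRep.mem_manifest_iff (S : SSRep P nu ny nx) (p : ℤ → P)
    (w : ℤ → Fin nu ⊕ Fin ny → ℝ) : (w, p) ∈ S.manifest ↔ ∃ x, S.IsTraj p w x := Iff.rfl

/-- The recursions of the observability and impulse response matrices hold along `p`. -/
structure SSRep.RegularAt (S : SSRep P nu ny nx) (p : ℤ → P) : Prop where
  obs_succ : ∀ i k, mdiamond (S.obs (i + 1)) p k =
    mdiamond (S.obs i) p (k + 1) * mdiamond S.A p k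
  imp_succ_zero : ∀ i k, mdiamond (S.imp (i + 1) 0) p k =
    mdiamond (S.obs i) p (k + 1) * mdiamond S.B p k
  imp_succ_succ : ∀ i j k, mdiamond (S.imp (i + 1) (j + 1)) p k = mdiamond (S.imp i j) p (k + 1)

theorem SSRep.ae_regularAt (hμ : IsAdmissible μ) (S : SSRep P nu ny nx) :
    ∀ᵐ p ∂μ, S.RegularAt p := by
  have h1 : ∀ᵐ p ∂μ, ∀ i k, mdiamond (mshift 1 (S.obs i) * S.A) p k =
      mdiamond (mshift 1 (S.obs i)) p k * mdiamond S.A p k :=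
    ae_all_iff.2 fun i => hμ.ae_mdiamond_mul _ _
  have h2 : ∀ᵐ p ∂μ, ∀ i k, mdiamond (mshift 1 (S.obs i) * S.B) p k =
      mdiamond (mshift 1 (S.obs i)) p k * mdiamond S.B p k :=
    ae_all_iff.2 fun i => hμ.ae_mdiamond_mul _ _
  have h3 : ∀ᵐ p ∂μ, ∀ i k, mdiamond (mshift 1 (S.obs i)) p k = mdiamond (S.obs i) p (k + 1) :=
    ae_all_iff.2 fun i => hμ.ae_mdiamond_mshift 1 _
  have h4 : ∀ᵐ p ∂μ, ∀ i j k, mdiamond (mshift 1 (S.imp i j)) p k =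
      mdiamond (S.imp i j) p (k + 1) :=
    ae_all_iff.2 fun i => ae_all_iff.2 fun j => hμ.ae_mdiamond_mshift 1 _
  filter_upwards [h1, h2, h3, h4] with p h1 h2 h3 h4
  exact ⟨fun i k => (h1 i k).trans (by rw [h3]), fun i k => (h2 i k).trans (by rw [h3]), h4⟩

/-- The output at time `k + i` minus its part caused by the inputs from time `k` on. -/
def SSRep.resid (S : SSRep P nu ny nx) (L : ℕ) (p : ℤ → P) (w : ℤ → Fin nu ⊕ Fin ny → ℝ)
    (i : ℕ) (k : ℤ) : Fin ny → ℝ :=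
  (fun a => w (k + i) (Sum.inr a)) -
    ∑ j ∈ Finset.range L, (mdiamond (S.imp i j) p k).mulVec fun b => w (k + j) (Sum.inl b)

theorem SSRep.resid_zero (S : SSRep P nu ny nx) (L : ℕ) (p : ℤ → P)
    (w : ℤ → Fin nu ⊕ Fin ny → ℝ) (k : ℤ) :
    S.resid (L + 1) p w 0 k = (fun a => w k (Sum.inr a)) -
      (mdiamond S.D p k).mulVec fun b => w k (Sum.inl b) := by
  rw [SSRep.resid, Finset.sum_range_succ', Finset.sum_eq_zero, zero_add]
  · simp [SSRep.imp]
  · intro j _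
    rw [SSRep.imp, mdiamond_zero, Matrix.zero_mulVec]

theorem SSRep.resid_succ_of_lt (S : SSRep P nu ny nx) {L : ℕ} (p : ℤ → P)
    (w : ℤ → Fin nu ⊕ Fin ny → ℝ) {i : ℕ} (hi : i < L) (k : ℤ) :
    S.resid (L + 1) p w i k = S.resid L p w i k := by
  rw [SSRep.resid, SSRep.resid, Finset.sum_range_succ, S.imp_eq_zero hi, mdiamond_zero,
    Matrix.zero_mulVec, add_zero]

theorem SSRep.RegularAt.resid_succ {S : SSRep P nu ny nx} {p : ℤ → P} (h : S.RegularAt p)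
    (L : ℕ) (w : ℤ → Fin nu ⊕ Fin ny → ℝ) (i : ℕ) (k : ℤ) :
    S.resid (L + 1) p w (i + 1) k = S.resid L p w i (k + 1) -
      (mdiamond (S.obs i) p (k + 1)).mulVec
        ((mdiamond S.B p k).mulVec fun b => w k (Sum.inl b)) := by
  have e : ∀ j : ℕ, k + ((j + 1 : ℕ) : ℤ) = k + 1 + j := fun j => by push_cast; ring
  rw [SSRep.resid, SSRep.resid, Finset.sum_range_succ', h.imp_succ_zero, Matrix.mulVec_mulVec]
  simp only [h.imp_succ_succ, e, Nat.cast_zero, add_zero]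
  abel

/-- The residual of index i + 1 at time k is that of index i at time k + 1 minus the effect of u(k),
so an induction on i that moves the time forward reduces everything to the output equation. The
bound `i < L` ensures that no input is left out. -/
theorem SSRep.RegularAt.resid_eq_obs {S : SSRep P nu ny nx} {p : ℤ → P} (h : S.RegularAt p)
    {w : ℤ → Fin nu ⊕ Fin ny → ℝ} {x : ℤ → Fin nx → ℝ} (hx : S.IsTraj p w x) (i : ℕ) :
    ∀ (L : ℕ) (k : ℤ), i < L → S.resid L p w i k = (mdiamond (S.obs i) p k).mulVec (x k) := by
  induction i with
  | zero =>
    intro L k hL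
    obtain ⟨L, rfl⟩ := Nat.exists_eq_succ_of_ne_zero hL.ne'
    rw [S.resid_zero, (hx k).2, add_sub_cancel_right]
    rfl
  | succ i ih =>
    intro L k hL
    obtain ⟨L, rfl⟩ := Nat.exists_eq_succ_of_ne_zero (Nat.zero_lt_of_lt hL).ne'
    rw [h.resid_succ, ih L (k + 1) (Nat.lt_of_succ_lt_succ hL), (hx k).1, Matrix.mulVec_add,
      add_sub_cancel_right, h.obs_succ, Matrix.mulVec_mulVec]

/-- If every state has a predecessor, every state and future input lie on a trajectory. -/
theorem SSRep.ae_exists_traj (hμ : IsAdmissible μ) (S : SSRep P nu ny nx)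
    (E : Matrix (Fin nx) (Fin nx) (Mero P)) (G : Matrix (Fin nu) (Fin nx) (Mero P))
    (hEG : S.A * E + S.B * G = 1) :
    ∀ᵐ p ∂μ, ∀ (x₀ : Fin nx → ℝ) (u : ℤ → Fin nu → ℝ), ∃ w x, S.IsTraj p w x ∧ x 0 = x₀ ∧
      ∀ k, 0 ≤ k → ∀ b, w k (Sum.inl b) = u k b := by
  filter_upwards [hμ.ae_mdiamond_mul S.A E, hμ.ae_mdiamond_mul S.B G,
    hμ.ae_mdiamond_add (S.A * E) (S.B * G)] with p h1 h2 h3 x₀ u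
  simp only [hEG, mdiamond_one, h1, h2] at h3
  -- Forward in time the input is u; backward, v' is reached from E v' under the input G v'. The
  -- exceptional null set depends on neither `x₀` nor `u`.
  obtain ⟨x, hx0, hx⟩ := exists_int_sequence (fun _ _ => True)
    (fun k v v' => ∃ c : Fin nu → ℝ, (0 ≤ k → c = u k) ∧
      v' = (mdiamond S.A p k).mulVec v + (mdiamond S.B p k).mulVec c) x₀ trivial
    (fun k _ v _ => ⟨_, trivial, u k, fun _ => rfl, rfl⟩)
    fun k hk v' _ => ⟨(mdiamond E p k).mulVec v', trivial, (mdiamond G p k).mulVec v',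
      fun h => absurd h (not_le.2 hk), by
        rw [Matrix.mulVec_mulVec, Matrix.mulVec_mulVec, ← Matrix.add_mulVec, ← h3,
          Matrix.one_mulVec]⟩
  choose c hc hcx using hx
  refine ⟨fun k => Sum.elim (c k) ((mdiamond S.C p k).mulVec (x k) +
    (mdiamond S.D p k).mulVec (c k)), x, fun k => ⟨hcx k, rfl⟩, hx0, fun k hk b => ?_⟩
  exact congrFun (hc k hk) b

theorem opApply_eq_sum_range {ι : Type} [Fintype ι] {n : ι → (Mero P)[X]} {L : ℕ}
    (hn : ∀ j, n j ∈ degreeLT (Mero P) L) (p : ℤ → P) (w : ℤ → ι → ℝ) (k : ℤ) :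
    opApply n p w k =
      ∑ j, ∑ i ∈ Finset.range L, diamond ((n j).coeff i) p k * w (k + i) j := by
  refine Finset.sum_congr rfl fun j _ => ?_
  refine Polynomial.sum_eq_of_subset _ (fun i => by rw [diamond_zero, zero_mul]) fun i hi => ?_
  rw [Finset.mem_range]
  by_contra hc
  exact mem_support_iff.1 hi
    (coeff_eq_zero_of_degree_lt ((mem_degreeLT.1 (hn j)).trans_le (by exact_mod_cast not_lt.1 hc)))

/-- The coefficient row of `u(k + j)` in `(n(q) ⋄ p) w` once the outputs are expressed by the state
and the inputs. -/
def SSRep.inputCoeff (S : SSRep P nu ny nx) (L : ℕ) (n : Fin nu ⊕ Fin ny → (Mero P)[X]) (j : ℕ)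
    (b : Fin nu) : Mero P :=
  (n (Sum.inl b)).coeff j +
    ∑ i ∈ Finset.range L, ∑ a, (n (Sum.inr a)).coeff i * S.imp i j a b

/-- Each output is split into its residual and the contribution of the inputs, and the latter is
collected in `inputCoeff`. This is an identity in `w`, on or off trajectories. -/
theorem SSRep.ae_opApply_eq (hμ : IsAdmissible μ) (S : SSRep P nu ny nx) {L : ℕ}
    {n : Fin nu ⊕ Fin ny → (Mero P)[X]} (hn : ∀ j, n j ∈ degreeLT (Mero P) L) :
    ∀ᵐ p ∂μ, ∀ w k, opApply n p w k =
      ∑ i ∈ Finset.range L, ∑ a, diamond ((n (Sum.inr a)).coeff i) p k * S.resid L p w i k a +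
      ∑ j ∈ Finset.range L, ∑ b, diamond (S.inputCoeff L n j b) p k * w (k + j) (Sum.inl b) := by
  have h1 : ∀ᵐ p ∂μ, ∀ j b k, diamond (S.inputCoeff L n j b) p k =
      diamond ((n (Sum.inl b)).coeff j) p k +
        diamond (∑ i ∈ Finset.range L, ∑ a, (n (Sum.inr a)).coeff i * S.imp i j a b) p k :=
    ae_all_iff.2 fun j => ae_all_iff.2 fun b => hμ.ae_diamond_add _ _
  have h2 : ∀ᵐ p ∂μ, ∀ j b k,
      diamond (∑ i ∈ Finset.range L, ∑ a, (n (Sum.inr a)).coeff i * S.imp i j a b) p k =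
        ∑ i ∈ Finset.range L, diamond (∑ a, (n (Sum.inr a)).coeff i * S.imp i j a b) p k :=
    ae_all_iff.2 fun j => ae_all_iff.2 fun b => hμ.ae_diamond_sum _ _
  have h3 : ∀ᵐ p ∂μ, ∀ (j : ℕ) b i k,
      diamond (∑ a, (n (Sum.inr a)).coeff i * S.imp i j a b) p k =
        ∑ a, diamond ((n (Sum.inr a)).coeff i * S.imp i j a b) p k :=
    ae_all_iff.2 fun j => ae_all_iff.2 fun b => ae_all_iff.2 fun i => hμ.ae_diamond_sum _ _
  have h4 : ∀ᵐ p ∂μ, ∀ (j : ℕ) b i a k,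
      diamond ((n (Sum.inr a)).coeff i * S.imp i j a b) p k =
        diamond ((n (Sum.inr a)).coeff i) p k * diamond (S.imp i j a b) p k :=
    ae_all_iff.2 fun j => ae_all_iff.2 fun b => ae_all_iff.2 fun i => ae_all_iff.2 fun a =>
      hμ.ae_diamond_mul _ _
  filter_upwards [h1, h2, h3, h4] with p h1 h2 h3 h4 w k
  rw [opApply_eq_sum_range hn, Fintype.sum_sum_type]
  simp only [h1, h2, h3, h4, add_mul, Finset.sum_add_distrib]
  have h5 : ∑ i ∈ Finset.range L, ∑ a, diamond ((n (Sum.inr a)).coeff i) p k *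
        S.resid L p w i k a =
      ∑ a, ∑ i ∈ Finset.range L, diamond ((n (Sum.inr a)).coeff i) p k * w (k + i) (Sum.inr a) -
      ∑ j ∈ Finset.range L, ∑ b, (∑ i ∈ Finset.range L, ∑ a,
        diamond ((n (Sum.inr a)).coeff i) p k * diamond (S.imp i j a b) p k) *
          w (k + j) (Sum.inl b) := by
    simp only [SSRep.resid, Pi.sub_apply, Finset.sum_apply, Matrix.mulVec, dotProduct, mdiamond,
      Matrix.map_apply, mul_sub, Finset.sum_sub_distrib, Finset.mul_sum, Finset.sum_mul]
    congr 1
    · rw [Finset.sum_comm]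
    · simp only [mul_assoc]
      refine Eq.trans (Finset.sum_congr rfl fun i _ => ?_) (Eq.trans Finset.sum_comm
        (Finset.sum_congr rfl fun j _ => Finset.sum_comm))
      exact Finset.sum_comm.trans (Finset.sum_congr rfl fun j _ => Finset.sum_comm)
  rw [h5, Finset.sum_comm (s := Finset.univ) (t := Finset.range L) (f := fun b j =>
    diamond ((n (Sum.inl b)).coeff j) p k * w (k + j) (Sum.inl b))]
  ring

/-! ### Annihilators as the left kernel of the observability matrix. -/

/-- The linear map `v ↦ ∑ i < L, vᵢ O i` on tuples of rows. -/
def rowCombination {F : Type*} [CommRing F] {m n : ℕ} (O : ℕ → Matrix (Fin m) (Fin n) F) (L : ℕ) :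
    (Fin L → Fin m → F) →ₗ[F] Fin n → F :=
  ∑ i : Fin L, (O i).vecMulLinear ∘ₗ LinearMap.proj i

theorem rowCombination_apply {F : Type*} [CommRing F] {m n : ℕ}
    (O : ℕ → Matrix (Fin m) (Fin n) F) (L : ℕ) (v : Fin L → Fin m → F) (c : Fin n) :
    rowCombination O L v c = ∑ i : Fin L, ∑ a, v i a * O i a c := by
  simp [rowCombination, LinearMap.sum_apply, Finset.sum_apply, Matrix.vecMul, dotProduct]

/-- Were the map not surjective, a non-zero v would annihilate its range; on unit tuples this reads
`O i` v = 0 for i < L. Vectors are taken as one-column matrices so that `ae_mdiamond_mul` applies to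
`O i * V`. -/
theorem finrank_ker_rowCombination_of_field {F : Type*} [Field F] {m n L : ℕ}
    (O : ℕ → Matrix (Fin m) (Fin n) F)
    (hO : ∀ V : Matrix (Fin n) (Fin 1) F, (∀ i < L, O i * V = 0) → V = 0) :
    Module.Finite F (LinearMap.ker (rowCombination O L)) ∧
      Module.finrank F (LinearMap.ker (rowCombination O L)) + n = m * L := by
  have h : Function.Surjective (rowCombination O L) := by
    rw [← LinearMap.range_eq_top]
    by_contra hne
    obtain ⟨v, hv0, hv⟩ := exists_dotProduct_eq_zero _ hne
    refine hv0 ?_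
    have h1 := hO (Matrix.of fun c _ => v c) fun i hi => by
      ext a z
      have := hv _ ⟨Pi.single ⟨i, hi⟩ (Pi.single a 1), rfl⟩
      simp only [rowCombination_apply] at this
      rw [Matrix.mul_apply, Matrix.zero_apply, ← this]
      refine Finset.sum_congr rfl fun c _ => ?_
      rw [Finset.sum_eq_single ⟨i, hi⟩]
      · simp [Pi.single_apply]
      · intro b _ hb
        simp [Pi.single_eq_of_ne hb]
      · simp
    ext c
    exact congrFun (congrFun h1 c) 0
  obtain ⟨h1, h2⟩ := finrank_ker_of_surjective _ h
  refine ⟨h1, h2.trans ?_⟩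
  rw [Module.finrank_pi_fintype]
  simp [mul_comm]

theorem finrank_ker_rowCombination {F : Type*} [CommRing F] (hF : IsField F) {m n L : ℕ}
    (O : ℕ → Matrix (Fin m) (Fin n) F)
    (hO : ∀ V : Matrix (Fin n) (Fin 1) F, (∀ i < L, O i * V = 0) → V = 0) :
    Module.Finite F (LinearMap.ker (rowCombination O L)) ∧
      Module.finrank F (LinearMap.ker (rowCombination O L)) + n = m * L :=
  @finrank_ker_rowCombination_of_field F hF.toField m n L O hO

/-- The rows of degree `< L` that annihilate a behaviour with a state-space representation in
which every state has a predecessor. -/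
theorem SSRep.mem_annihilators_iff (hμ : IsAdmissible μ) {𝔅 : Behaviour P (Fin nu ⊕ Fin ny)}
    (S : SSRep P nu ny nx) (hS : S.Represents μ 𝔅) (E : Matrix (Fin nx) (Fin nx) (Mero P))
    (G : Matrix (Fin nu) (Fin nx) (Mero P)) (hEG : S.A * E + S.B * G = 1) {L : ℕ}
    {n : Fin nu ⊕ Fin ny → (Mero P)[X]} (hn : ∀ j, n j ∈ degreeLT (Mero P) L) :
    n ∈ annihilators μ hμ 𝔅 ↔
      rowCombination S.obs L (fun i a => (n (Sum.inr a)).coeff i) = 0 ∧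
        ∀ j < L, ∀ b, S.inputCoeff L n j b = 0 := by
  set α := rowCombination S.obs L (fun i a => (n (Sum.inr a)).coeff i) with hα
  have hsum : ∀ c, α c = ∑ i ∈ Finset.range L, ∑ a, (n (Sum.inr a)).coeff i * S.obs i a c :=
    fun c => by
      rw [hα, rowCombination_apply, Finset.sum_range fun i =>
        ∑ a, (n (Sum.inr a)).coeff i * S.obs i a c]
  have h1 : ∀ᵐ p ∂μ, ∀ c k, diamond (α c) p k = ∑ i ∈ Finset.range L,
      diamond (∑ a, (n (Sum.inr a)).coeff i * S.obs i a c) p k :=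
    ae_all_iff.2 fun c => by rw [hsum]; exact hμ.ae_diamond_sum _ _
  have h2 : ∀ᵐ p ∂μ, ∀ i c k, diamond (∑ a, (n (Sum.inr a)).coeff i * S.obs i a c) p k =
      ∑ a, diamond ((n (Sum.inr a)).coeff i * S.obs i a c) p k :=
    ae_all_iff.2 fun i => ae_all_iff.2 fun c => hμ.ae_diamond_sum _ _
  have h3 : ∀ᵐ p ∂μ, ∀ i a c k, diamond ((n (Sum.inr a)).coeff i * S.obs i a c) p k =
      diamond ((n (Sum.inr a)).coeff i) p k * diamond (S.obs i a c) p k :=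
    ae_all_iff.2 fun i => ae_all_iff.2 fun a => ae_all_iff.2 fun c => hμ.ae_diamond_mul _ _
  have key : ∀ᵐ p ∂μ, ∀ w x, S.IsTraj p w x → ∀ k, opApply n p w k =
      ∑ c, diamond (α c) p k * x k c +
      ∑ j ∈ Finset.range L, ∑ b, diamond (S.inputCoeff L n j b) p k * w (k + j) (Sum.inl b) := by
    filter_upwards [h1, h2, h3, S.ae_opApply_eq hμ hn, S.ae_regularAt hμ]
      with p h1 h2 h3 h4 h5 w x hx k
    rw [h4]
    congr 1
    simp only [h1, h2, h3, Finset.sum_mul]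
    symm
    rw [Finset.sum_comm]
    refine Finset.sum_congr rfl fun i hi => ?_
    rw [Finset.sum_comm]
    refine Finset.sum_congr rfl fun a _ => ?_
    rw [h5.resid_eq_obs hx i L k (Finset.mem_range.1 hi)]
    simp only [Matrix.mulVec, dotProduct, Finset.mul_sum, mdiamond, Matrix.map_apply, mul_assoc]
  constructor
  · intro h
    replace h : ∀ᵐ p ∂μ, ∀ w, (w, p) ∈ 𝔅 → ∀ k, opApply n p w k = 0 := h
    -- All states and future inputs occur at time 0, so the linear form itself vanishes; unit
    -- vectors then isolate its coefficients.
    have hz : ∀ᵐ p ∂μ, ∀ (x₀ : Fin nx → ℝ) (u : ℤ → Fin nu → ℝ),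
        ∑ c, diamond (α c) p 0 * x₀ c +
          ∑ j ∈ Finset.range L, ∑ b, diamond (S.inputCoeff L n j b) p 0 * u j b = 0 := by
      filter_upwards [h, key, hS, S.ae_exists_traj hμ E G hEG] with p h1 h2 h3 h4 x₀ u
      obtain ⟨w, x, hx, rfl, hw⟩ := h4 x₀ u
      rw [← h1 w ((h3 w).2 ⟨x, hx⟩) 0, h2 w x hx 0]
      congr 1
      refine Finset.sum_congr rfl fun j _ => Finset.sum_congr rfl fun b _ => ?_
      rw [hw _ (by positivity), zero_add]
    refine ⟨?_, fun j hj b => ?_⟩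
    · ext c
      refine hμ.eq_zero_of_ae_diamond _ ?_
      filter_upwards [hz] with p hp
      simpa [Pi.single_apply] using hp (Pi.single c 1) 0
    · refine hμ.eq_zero_of_ae_diamond _ ?_
      filter_upwards [hz] with p hp
      have := hp 0 (Pi.single (j : ℤ) (Pi.single b 1))
      rw [Finset.sum_eq_single_of_mem j (Finset.mem_range.2 hj)] at this
      · simpa [Pi.single_apply] using this
      · intro i _ hi
        have : (i : ℤ) ≠ j := by exact_mod_cast hi
        simp [Pi.single_eq_of_ne this]
  · rintro ⟨h, h'⟩
    have : ∀ᵐ p ∂μ, ∀ w, (w, p) ∈ 𝔅 → ∀ k, opApply n p w k = 0 := by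
      filter_upwards [key, hS] with p h1 h2 w hw k
      obtain ⟨x, hx⟩ := (h2 w).1 hw
      rw [h1 w x hx, h, Finset.sum_eq_zero, Finset.sum_eq_zero, add_zero]
      · intro j hj
        refine Finset.sum_eq_zero fun b _ => ?_
        rw [h' j (Finset.mem_range.1 hj), diamond_zero, zero_mul]
      · intro c _
        rw [Pi.zero_apply, diamond_zero, zero_mul]
    exact this

/-- The row with given output coefficients that cancels all inputs. -/
def SSRep.row (S : SSRep P nu ny nx) (L : ℕ) (v : ℕ → Fin ny → Mero P) :
    Fin nu ⊕ Fin ny → (Mero P)[X] :=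
  Sum.elim
    (fun b => ∑ j ∈ Finset.range L,
      monomial j (-∑ i ∈ Finset.range L, ∑ a, v i a * S.imp i j a b))
    fun a => ∑ i ∈ Finset.range L, monomial i (v i a)

theorem sum_monomial_mem_degreeLT {R : Type*} [CommRing R] (L : ℕ) (c : ℕ → R) :
    ∑ i ∈ Finset.range L, monomial i (c i) ∈ degreeLT R L :=
  Submodule.sum_mem _ fun i hi => mem_degreeLT.2
    ((degree_monomial_le _ _).trans_lt (by exact_mod_cast Finset.mem_range.1 hi))

theorem coeff_sum_monomial {R : Type*} [CommRing R] {L : ℕ} (c : ℕ → R) {j : ℕ} (hj : j < L) :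
    (∑ i ∈ Finset.range L, monomial i (c i)).coeff j = c j := by
  simp [coeff_monomial, hj]

theorem SSRep.row_mem_degreeLT (S : SSRep P nu ny nx) (L : ℕ) (v : ℕ → Fin ny → Mero P) :
    ∀ j, S.row L v j ∈ degreeLT (Mero P) L
  | Sum.inl _ => sum_monomial_mem_degreeLT L _
  | Sum.inr _ => sum_monomial_mem_degreeLT L _

theorem SSRep.row_coeff_inr (S : SSRep P nu ny nx) {L : ℕ} (v : ℕ → Fin ny → Mero P) (a : Fin ny)
    {i : ℕ} (hi : i < L) : (S.row L v (Sum.inr a)).coeff i = v i a :=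
  coeff_sum_monomial (fun i => v i a) hi

theorem SSRep.inputCoeff_row (S : SSRep P nu ny nx) {L : ℕ} (v : ℕ → Fin ny → Mero P) {j : ℕ}
    (hj : j < L) (b : Fin nu) : S.inputCoeff L (S.row L v) j b = 0 := by
  have h1 : (S.row L v (Sum.inl b)).coeff j =
      -∑ i ∈ Finset.range L, ∑ a, v i a * S.imp i j a b :=
    coeff_sum_monomial (fun j => -∑ i ∈ Finset.range L, ∑ a, v i a * S.imp i j a b) hj
  rw [SSRep.inputCoeff, h1, neg_add_eq_zero]
  refine Finset.sum_congr rfl fun i hi => Finset.sum_congr rfl fun a _ => ?_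
  rw [S.row_coeff_inr v a (Finset.mem_range.1 hi)]

theorem SSRep.ae_opApply_row (hμ : IsAdmissible μ) (S : SSRep P nu ny nx) (L : ℕ)
    (v : ℕ → Fin ny → Mero P) :
    ∀ᵐ p ∂μ, ∀ w k, opApply (S.row L v) p w k =
      ∑ i ∈ Finset.range L, ∑ a, diamond (v i a) p k * S.resid L p w i k a := by
  filter_upwards [S.ae_opApply_eq hμ (S.row_mem_degreeLT L v)] with p hp w k
  rw [hp, Finset.sum_eq_zero (s := Finset.range L) (f := fun j =>
    ∑ b, diamond (S.inputCoeff L (S.row L v) j b) p k * w (k + j) (Sum.inl b)), add_zero]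
  · refine Finset.sum_congr rfl fun i hi => Finset.sum_congr rfl fun a _ => ?_
    rw [S.row_coeff_inr v a (Finset.mem_range.1 hi)]
  · intro j hj
    refine Finset.sum_eq_zero fun b _ => ?_
    rw [S.inputCoeff_row v (Finset.mem_range.1 hj), diamond_zero, zero_mul]

/-- The annihilators of degree `< L` correspond to the left kernel of the observability matrix. -/
theorem SSRep.nonempty_annihilatorsLT_equiv (hμ : IsAdmissible μ)
    {𝔅 : Behaviour P (Fin nu ⊕ Fin ny)} (S : SSRep P nu ny nx) (hS : S.Represents μ 𝔅)
    (E : Matrix (Fin nx) (Fin nx) (Mero P)) (G : Matrix (Fin nu) (Fin nx) (Mero P))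
    (hEG : S.A * E + S.B * G = 1) (L : ℕ) :
    Nonempty (annihilatorsLT μ hμ 𝔅 L ≃ₗ[Mero P] LinearMap.ker (rowCombination S.obs L)) := by
  have hdeg : ∀ n ∈ annihilatorsLT μ hμ 𝔅 L, ∀ j, n j ∈ degreeLT (Mero P) L :=
    fun n hn j => hn.2 j (Set.mem_univ _)
  have hmem := fun n (hn : n ∈ annihilatorsLT μ hμ 𝔅 L) =>
    (S.mem_annihilators_iff hμ hS E G hEG (hdeg n hn)).1 hn.1
  let f : annihilatorsLT μ hμ 𝔅 L →ₗ[Mero P] LinearMap.ker (rowCombination S.obs L) :=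
    { toFun := fun n => ⟨fun i a => (n.1 (Sum.inr a)).coeff i, (hmem n.1 n.2).1⟩
      map_add' := fun n m => by ext i a; simp
      map_smul' := fun c n => by ext i a; simp }
  refine ⟨LinearEquiv.ofBijective f ⟨?_, ?_⟩⟩
  · rw [injective_iff_map_eq_zero]
    rintro ⟨n, hn⟩ h0
    have hy : ∀ a i, i < L → (n (Sum.inr a)).coeff i = 0 := fun a i hi =>
      congrFun (congrFun (congrArg Subtype.val h0) ⟨i, hi⟩) a
    -- With zero output part, `inputCoeff` is just the input coefficient.
    have hu : ∀ b j, j < L → (n (Sum.inl b)).coeff j = 0 := fun b j hj => by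
      have h1 := (hmem n hn).2 j hj b
      rwa [SSRep.inputCoeff, Finset.sum_eq_zero, add_zero] at h1
      intro i hi
      refine Finset.sum_eq_zero fun a _ => ?_
      rw [hy a i (Finset.mem_range.1 hi), zero_mul]
    ext j i
    change (n j).coeff i = 0
    rcases lt_or_ge i L with hi | hi
    · rcases j with b | a
      · exact hu b i hi
      · exact hy a i hi
    · exact coeff_eq_zero_of_degree_lt
        ((mem_degreeLT.1 (hdeg n hn j)).trans_le (by exact_mod_cast hi))
  · rintro ⟨v, hv⟩
    let v' : ℕ → Fin ny → Mero P := fun i a => if h : i < L then v ⟨i, h⟩ a else 0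
    have h1 : (fun (i : Fin L) a => (S.row L v' (Sum.inr a)).coeff i) = v := by
      ext i a
      rw [S.row_coeff_inr v' a i.2]
      simp [v']
    refine ⟨⟨S.row L v', (S.mem_annihilators_iff hμ hS E G hEG (S.row_mem_degreeLT L v')).2
      ⟨by rw [h1]; exact hv, fun j hj b => S.inputCoeff_row v' hj b⟩,
      fun j _ => S.row_mem_degreeLT L v' j⟩, Subtype.ext h1⟩

/-! ### Kernel representations and the lag. -/

/-- An observable state-space representation yields a kernel representation. -/
theorem SSRep.exists_isKernelRep (hμ : IsAdmissible μ) {𝔅 : Behaviour P (Fin nu ⊕ Fin ny)}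
    (S : SSRep P nu ny nx) (hS : S.Represents μ 𝔅) {K : ℕ}
    (G : ℕ → Matrix (Fin nx) (Fin ny) (Mero P))
    (hG : ∑ i ∈ Finset.range K, G i * S.obs i = 1) :
    ∃ (nr : ℕ) (R : Matrix (Fin nr) (Fin nu ⊕ Fin ny) (Mero P)[X]), IsKernelRep μ R 𝔅 := by
  -- The weight of index K is zero: equations are imposed for the indices 0, …, K, but the state is
  -- reconstructed from 0, …, K - 1 only. The spare index allows the passage from time k to k + 1.
  let G' : ℕ → Matrix (Fin nx) (Fin ny) (Mero P) := fun i => if i < K then G i else 0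
  have hG' : ∑ i ∈ Finset.range (K + 1), G' i * S.obs i = 1 := by
    rw [Finset.sum_range_succ, ← hG]
    simp only [G', lt_irrefl, if_false, Matrix.zero_mul, add_zero]
    refine Finset.sum_congr rfl fun i hi => ?_
    rw [if_pos (Finset.mem_range.1 hi)]
  have hG0 : ∀ p k, mdiamond (G' K) p k = 0 := fun p k => by simp [G', mdiamond_zero]
  -- The blocks of 1 - O G', a projection since G' O = 1, whose kernel is the image of the stacked
  -- observability matrix O.
  let V : ℕ → ℕ → Matrix (Fin ny) (Fin ny) (Mero P) := fun i j =>
    (if i = j then 1 else 0) - S.obs i * G' j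
  let e : Fin ((K + 1) * ny) ≃ Fin (K + 1) × Fin ny := finProdFinEquiv.symm
  refine ⟨(K + 1) * ny, fun z => S.row (K + 1) fun j => V (e z).1 j (e z).2, ?_⟩
  have h1 : ∀ᵐ p ∂μ, ∀ z w k, opApply (S.row (K + 1) fun j => V (e z).1 j (e z).2) p w k =
      ∑ i ∈ Finset.range (K + 1), ∑ a, diamond (V (e z).1 i (e z).2 a) p k *
        S.resid (K + 1) p w i k a := ae_all_iff.2 fun z => S.ae_opApply_row hμ _ _
  have h2 : ∀ᵐ p ∂μ, ∀ i j k, mdiamond (V i j) p k =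
      mdiamond (if i = j then 1 else 0) p k - mdiamond (S.obs i * G' j) p k :=
    ae_all_iff.2 fun i => ae_all_iff.2 fun j => hμ.ae_mdiamond_sub _ _
  have h3 : ∀ᵐ p ∂μ, ∀ i j k, mdiamond (S.obs i * G' j) p k =
      mdiamond (S.obs i) p k * mdiamond (G' j) p k :=
    ae_all_iff.2 fun i => ae_all_iff.2 fun j => hμ.ae_mdiamond_mul _ _
  have h4 : ∀ᵐ p ∂μ, ∀ i k, mdiamond (G' i * S.obs i) p k =
      mdiamond (G' i) p k * mdiamond (S.obs i) p k :=
    ae_all_iff.2 fun i => hμ.ae_mdiamond_mul _ _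
  filter_upwards [hS, S.ae_regularAt hμ, h1, h2, h3, h4,
    hμ.ae_mdiamond_sum (Finset.range (K + 1)) fun i => G' i * S.obs i] with
    p hS hp h1 h2 h3 h4 h5 w
  simp only [hG', mdiamond_one, h4] at h5
  -- The only possible state: on a trajectory the left inverse returns x(k).
  let ξ : ℤ → Fin nx → ℝ := fun k => ∑ j ∈ Finset.range (K + 1),
    (mdiamond (G' j) p k).mulVec (S.resid (K + 1) p w j k)
  have hrow : ∀ z k, opApply (S.row (K + 1) fun j => V (e z).1 j (e z).2) p w k =
      (S.resid (K + 1) p w (e z).1 k - (mdiamond (S.obs (e z).1) p k).mulVec (ξ k)) (e z).2 := by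
    intro z k
    have h6 : ∀ i, ∑ a, diamond (V (e z).1 i (e z).2 a) p k * S.resid (K + 1) p w i k a =
        (mdiamond (V (e z).1 i) p k).mulVec (S.resid (K + 1) p w i k) (e z).2 := fun i => rfl
    rw [h1]
    simp only [h6]
    rw [← Finset.sum_apply]
    simp only [h2, h3, Matrix.sub_mulVec, Finset.sum_sub_distrib, ξ, Matrix.mulVec_sum,
      Matrix.mulVec_mulVec]
    rw [Finset.sum_eq_single_of_mem ((e z).1 : ℕ) (Finset.mem_range.2 (e z).1.2)]
    · rw [if_pos rfl, mdiamond_one, Matrix.one_mulVec]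
    · intro j _ hj
      rw [if_neg hj.symm, mdiamond_zero, Matrix.zero_mulVec]
  have hrows : (∀ k z, opApply (S.row (K + 1) fun j => V (e z).1 j (e z).2) p w k = 0) ↔
      ∀ k, ∀ i < K + 1, S.resid (K + 1) p w i k = (mdiamond (S.obs i) p k).mulVec (ξ k) := by
    refine forall_congr' fun k => ⟨fun h i hi => ?_, fun h z => ?_⟩
    · ext a
      have := h (e.symm (⟨i, hi⟩, a))
      rw [hrow, e.apply_symm_apply] at this
      exact sub_eq_zero.1 this
    · rw [hrow, h _ (e z).1.2, sub_self, Pi.zero_apply]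
  rw [hrows, hS w, S.mem_manifest_iff]
  constructor
  · rintro ⟨x, hx⟩ k i hi
    rw [hp.resid_eq_obs hx i _ k hi]
    congr 1
    have : ξ k = ∑ j ∈ Finset.range (K + 1),
        (mdiamond (G' j) p k * mdiamond (S.obs j) p k).mulVec (x k) :=
      Finset.sum_congr rfl fun j hj => by
        rw [hp.resid_eq_obs hx j _ k (Finset.mem_range.1 hj), Matrix.mulVec_mulVec]
    rw [this, ← Matrix.sum_mulVec, ← h5, Matrix.one_mulVec]
  · intro h
    refine ⟨ξ, fun k => ⟨?_, ?_⟩⟩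
    · set v := (mdiamond S.A p k).mulVec (ξ k) +
        (mdiamond S.B p k).mulVec fun b => w k (Sum.inl b) with hv
      -- The equation of index j + 1 at time k, with the effect of u(k) moved to the other side.
      have h7 : ∀ j < K, S.resid (K + 1) p w j (k + 1) =
          (mdiamond (S.obs j) p (k + 1)).mulVec v := fun j hj => by
        have h8 := hp.resid_succ K w j k
        rw [h k (j + 1) (Nat.succ_lt_succ hj), hp.obs_succ, ← S.resid_succ_of_lt p w hj,
          eq_sub_iff_add_eq] at h8
        rw [← h8, hv, Matrix.mulVec_add, Matrix.mulVec_mulVec (ξ k)]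
      calc ξ (k + 1) = ∑ j ∈ Finset.range (K + 1),
            (mdiamond (G' j) p (k + 1) * mdiamond (S.obs j) p (k + 1)).mulVec v := by
            simp only [ξ, Finset.sum_range_succ, hG0, Matrix.zero_mul, Matrix.zero_mulVec]
            congr 1
            refine Finset.sum_congr rfl fun j hj => ?_
            rw [h7 j (Finset.mem_range.1 hj), Matrix.mulVec_mulVec]
        _ = v := by rw [← Matrix.sum_mulVec, ← h5, Matrix.one_mulVec]
    · have h7 := h k 0 (Nat.succ_pos K)
      rw [S.resid_zero, sub_eq_iff_eq_add] at h7
      exact h7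

/-- If there is a kernel representation of order at most `L`, the first `L` observability matrices
of an observable representation already separate the states. -/
theorem SSRep.eq_zero_of_obs_mul_eq_zero (hμ : IsAdmissible μ)
    {𝔅 : Behaviour P (Fin nu ⊕ Fin ny)} (S : SSRep P nu ny nx) (hS : S.Represents μ 𝔅)
    (E : Matrix (Fin nx) (Fin nx) (Mero P)) (H : Matrix (Fin nu) (Fin nx) (Mero P))
    (hEH : S.A * E + S.B * H = 1) {K : ℕ} (G : ℕ → Matrix (Fin nx) (Fin ny) (Mero P))
    (hG : ∑ i ∈ Finset.range K, G i * S.obs i = 1) {nr L : ℕ}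
    (R : Matrix (Fin nr) (Fin nu ⊕ Fin ny) (Mero P)[X]) (hR : IsKernelRep μ R 𝔅)
    (hL : order R ≤ L) (V : Matrix (Fin nx) (Fin 1) (Mero P)) (hV : ∀ i < L, S.obs i * V = 0) :
    V = 0 := by
  have hdeg : ∀ i j, R i j ∈ degreeLT (Mero P) (L + 1) := fun i j => by
    refine mem_degreeLT.2 (degree_le_natDegree.trans_lt ?_)
    have h1 : (R i j).natDegree ≤ order R :=
      (Finset.le_sup (f := fun j => (R i j).natDegree) (Finset.mem_univ j)).trans
        (Finset.le_sup (f := fun i => Finset.univ.sup fun j => (R i j).natDegree)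
          (Finset.mem_univ i))
    exact_mod_cast Nat.lt_succ_of_le (h1.trans hL)
  have h1 : ∀ᵐ p ∂μ, ∀ i k, mdiamond (S.obs i * V) p k =
      mdiamond (S.obs i) p k * mdiamond V p k :=
    ae_all_iff.2 fun i => hμ.ae_mdiamond_mul _ _
  have h2 : ∀ᵐ p ∂μ, ∀ i k, mdiamond (G i * S.obs i) p k =
      mdiamond (G i) p k * mdiamond (S.obs i) p k :=
    ae_all_iff.2 fun i => hμ.ae_mdiamond_mul _ _
  suffices h : ∀ᵐ p ∂μ, ∀ c, diamond (V c 0) p 0 = 0 by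
    ext c z
    rw [Subsingleton.elim z 0]
    exact hμ.eq_zero_of_ae_diamond _ (h.mono fun p hp => hp c)
  filter_upwards [h1, h2, S.ae_regularAt hμ, hS, hR, S.ae_exists_traj hμ E H hEH,
    hμ.ae_mdiamond_sum (Finset.range K) fun i => G i * S.obs i] with p h1 h2 hp hS hR hT h3
  simp only [hG, mdiamond_one, h2] at h3
  have hobs : ∀ k v, (∀ i < K, (mdiamond (S.obs i) p k).mulVec v = 0) → v = 0 := by
    intro k v hv
    rw [← Matrix.one_mulVec v, h3 k, Matrix.sum_mulVec]
    refine Finset.sum_eq_zero fun i hi => ?_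
    rw [← Matrix.mulVec_mulVec, hv i (Finset.mem_range.1 hi), Matrix.mulVec_zero]
  -- The trajectory through the value of V at time 0, with zero input from then on.
  obtain ⟨w, x, hx, hx0, hw⟩ := hT (fun c => diamond (V c 0) p 0) 0
  have hy : ∀ i : ℕ, (fun a => w i (Sum.inr a)) = (mdiamond (S.obs i) p 0).mulVec (x 0) := by
    intro i
    rw [← hp.resid_eq_obs hx i (i + 1) 0 (Nat.lt_succ_self i), SSRep.resid, Finset.sum_eq_zero,
      sub_zero, zero_add]
    intro j _
    have : (fun b => w (0 + j) (Sum.inl b)) = 0 := by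
      ext b
      exact hw _ (by positivity) b
    rw [this, Matrix.mulVec_zero]
  have hwL : ∀ i : ℕ, i < L → w i = 0 := by
    intro i hi
    have h4 := hy i
    have h5 : (mdiamond (S.obs i) p 0).mulVec (x 0) = 0 := by
      ext a
      have h6 := congrFun (congrFun (h1 i 0) a) 0
      rw [hV i hi, mdiamond_zero, Matrix.mul_apply] at h6
      rw [hx0]
      exact h6.symm
    ext j
    rcases j with b | a
    · exact hw i (by positivity) b
    · exact congrFun (h4.trans h5) a
  -- The past is cut off. As w vanishes at times 0, …, L - 1, the cut signal is zero before time L.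
  let w' : ℤ → Fin nu ⊕ Fin ny → ℝ := fun k => if 0 ≤ k then w k else 0
  have hw'L : ∀ k < (L : ℤ), w' k = 0 := fun k hk => by
    by_cases h : 0 ≤ k
    · lift k to ℕ using h
      simp only [w', Nat.cast_nonneg, if_true]
      exact hwL k (by exact_mod_cast hk)
    · simp only [w', if_neg h]
  have hw'u : ∀ k b, w' k (Sum.inl b) = 0 := fun k b => by
    by_cases h : 0 ≤ k
    · simp only [w', if_pos h]
      exact hw k h b
    · simp only [w', if_neg h, Pi.zero_apply]
  have hw' : (w', p) ∈ 𝔅 := by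
    rw [hR]
    intro k i
    rw [opApply_eq_sum_range (hdeg i)]
    rcases le_or_gt 0 k with hk | hk
    · have h4 := (hR w).1 ((hS w).2 ⟨x, hx⟩) k i
      rw [opApply_eq_sum_range (hdeg i)] at h4
      rw [← h4]
      refine Finset.sum_congr rfl fun j _ => Finset.sum_congr rfl fun l _ => ?_
      have : (0 : ℤ) ≤ k + l := by positivity
      simp only [w', if_pos this]
    -- A window of L + 1 samples starting before time 0 ends before time L, where `w'` is zero.
    · refine Finset.sum_eq_zero fun j _ => Finset.sum_eq_zero fun l hl => ?_
      have := Finset.mem_range.1 hl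
      rw [hw'L (k + l) (by omega), Pi.zero_apply, mul_zero]
  obtain ⟨x', hx'⟩ := (hS w').1 hw'
  replace hx' : S.IsTraj p w' x' := hx'
  have hu : ∀ k, (fun b => w' k (Sum.inl b)) = 0 := fun k => funext (hw'u k)
  -- `w'` is zero at the K times -K, …, -1, which determine the state at -K by observability.
  have hx'0 : x' (-K) = 0 := by
    refine hobs (-K) _ fun i hi => ?_
    rw [← hp.resid_eq_obs hx' i K (-K) hi, SSRep.resid, Finset.sum_eq_zero, sub_zero]
    · have : ¬ (0 : ℤ) ≤ -K + i := by omega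
      simp only [w', if_neg this]
      rfl
    · intro j _
      rw [hu, Matrix.mulVec_zero]
  have hx'z : ∀ m : ℕ, x' (-K + m) = 0 := fun m => by
    induction m with
    | zero => simpa using hx'0
    | succ m ih =>
      have := (hx' (-K + m)).1
      rw [ih, hu, Matrix.mulVec_zero, Matrix.mulVec_zero, add_zero] at this
      rw [← this]
      push_cast
      ring_nf
  have hx0' : x 0 = 0 := by
    refine hobs 0 _ fun i _ => ?_
    have h4 := (hx' i).2
    have h5 := hx'z (K + i)
    rw [show (-K + (K + i : ℕ) : ℤ) = i by push_cast; ring] at h5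
    rw [h5, hu, Matrix.mulVec_zero, Matrix.mulVec_zero, add_zero] at h4
    rw [← hy, ← h4]
    simp [w']
  intro c
  exact congrFun (hx0.symm.trans hx0') c

end LPV

end

/-! ### The dimension formula. -/

theorem mainTheorem2 {np nu ny nx : ℕ} (P : Set (Fin np → ℝ)) (hPo : IsOpen P)
    (hPc : IsConnected P) (μ : MeasureTheory.Measure (ℤ → P)) (hμ : LPV.IsAdmissible μ)
    (𝔅 : LPV.Behaviour P (Fin nu ⊕ Fin ny)) (S : LPV.SSRep P nu ny nx)
    (hS : S.Represents μ 𝔅) (L : ℕ) (hL : LPV.lag μ 𝔅 ≤ L) :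
    Module.Finite (LPV.Mero P) (LPV.annihilatorsLT μ hμ 𝔅 L) ∧
      (Module.finrank (LPV.Mero P) (LPV.annihilatorsLT μ hμ 𝔅 L) : ℤ) =
        (ny : ℤ) * L - LPV.minStateDim μ 𝔅 := by
  obtain ⟨S₁, hS₁, ⟨E, H, hEH⟩, K, G, hG⟩ := LPV.exists_minimal_rep hPo hPc hμ 𝔅 S hS
  obtain ⟨nr₀, R₀, hR₀⟩ := S₁.exists_isKernelRep hμ hS₁ G hG
  -- The infimum of an empty set would be 0; existence of a kernel representation ensures that the
  -- lag is attained.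
  obtain ⟨nr, R, hR, hRo⟩ := Nat.sInf_mem
    (⟨_, nr₀, R₀, hR₀, rfl⟩ : {l | ∃ (nr : ℕ) (R : Matrix (Fin nr) (Fin nu ⊕ Fin ny)
      (Polynomial (LPV.Mero P))), LPV.IsKernelRep μ R 𝔅 ∧ LPV.order R = l}.Nonempty)
  obtain ⟨h1, h2⟩ := LPV.finrank_ker_rowCombination (LPV.isField_mero hPo hPc) S₁.obs
    (S₁.eq_zero_of_obs_mul_eq_zero hμ hS₁ E H hEH G hG R hR (hRo.le.trans hL))
  obtain ⟨f⟩ := S₁.nonempty_annihilatorsLT_equiv hμ hS₁ E H hEH L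
  refine ⟨Module.Finite.equiv f.symm, ?_⟩
  rw [f.finrank_eq, eq_sub_iff_add_eq]
  exact_mod_cast h2
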